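/- A maximal outerplanar graph is a finite simple graph of order at least $3$ that has a plane embedding in which the outer face is bounded by a cycle containing all the vertices and every inner face is a triangle. A set $S$ of vertices of a graph $G$ is a disjunctive dominating set if every vertex outside $S$ has a neighbor in $S$ or has at least two vertices of $S$ at distance $2$ from it; the disjunctive domination number $\gamma_2^d(G)$ is the minimum cardinality of a disjunctive dominating set of $G$. If $G$ is a maximal outerplanar graph of order $n \ge 7$ with $k$ vertices of degree $2$, then $$\gamma_2^d(G) \le \left\lfloor \tfrac{2}{9}(n+k) \right\rfloor .$$ Moreover, the bound is sharp: there is a maximal outerplanar graph of order $n \ge 7$, with $k$ vertices of degree $2$, for which equality holds. -/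

import Mathlib

namespace DisjDom

/-- A plane embedding of a connected graph `G` (with at least one edge), in its combinatorial form:
a rotation system, giving the cyclic order of the edges around every vertex, whose faces satisfy
Euler's formula `|V| - |E| + |F| = 2`, together with the choice of the outer face.
By the Heffter-Edmonds principle these are the embeddings of `G` in the plane up to homeomorphism.
A dart is an edge with a direction. -/
structure PlaneEmbedding {V : Type*} (G : SimpleGraph V) where
  /-- The rotation: `rot d` is the dart that follows `d` in the cyclic order around the tail
  of `d`. -/
  rot : Equiv.Perm G.Dart
  /-- The rotation keeps the tail of a dart. -/
  rot_fst : ∀ d, (rot d).fst = d.fst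
  /-- The darts with a given tail form one single cycle of the rotation. -/
  rot_cyclic : ∀ d d' : G.Dart, d.fst = d'.fst → rot.SameCycle d d'
  /-- `G` is connected. -/
  connected : G.Connected
  /-- Euler's formula. The faces are the cycles of the permutation `d ↦ rot d.symm`, which sends
  a dart to the next one along the boundary of the face. -/
  euler : Nat.card V
      + Nat.card (Quotient (Equiv.Perm.SameCycle.setoid
          ((SimpleGraph.Dart.symm_involutive (G := G)).toPerm.trans rot)))
      = G.edgeSet.ncard + 2
  /-- A dart on the boundary of the outer face. -/
  outer : G.Dart

namespace PlaneEmbedding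

variable {V : Type*} {G : SimpleGraph V} (M : PlaneEmbedding G)

/-- The face permutation `d ↦ rot d.symm`: it sends a dart to its successor along the boundary
walk of the face to which it belongs. -/
def facePerm : Equiv.Perm G.Dart :=
  (SimpleGraph.Dart.symm_involutive (G := G)).toPerm.trans M.rot

/-- The boundary walk of the face to which the dart `d` belongs, as a set of darts. -/
def face (d : G.Dart) : Set G.Dart := {e | M.facePerm.SameCycle d e}

/-- The boundary walk of the outer face, as a set of darts. -/
def outerFace : Set G.Dart := M.face M.outer

end PlaneEmbedding

/-- `G` is a maximal outerplanar graph (mop): it has a plane embedding in which the boundary of the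
outer face is a cycle through all the vertices (the boundary walk leaves every vertex exactly
once) and every inner face is a triangle. -/
def IsMaximalOuterplanar {V : Type*} (G : SimpleGraph V) : Prop :=
  3 ≤ Nat.card V ∧
  ∃ M : PlaneEmbedding G,
    (∀ v : V, ∃! d : G.Dart, d ∈ M.outerFace ∧ d.fst = v) ∧
    ∀ d : G.Dart, d ∉ M.outerFace → (M.face d).ncard = 3

/-- `S` is a disjunctive dominating set of `G`: every vertex outside `S` has a neighbour in `S` or
has at least two vertices of `S` at distance `2` from it. -/
def IsDisjunctiveDominating {V : Type*} (G : SimpleGraph V) (S : Set V) : Prop :=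
  ∀ v, v ∉ S → (∃ u ∈ S, G.Adj v u) ∨
    ∃ u ∈ S, ∃ w ∈ S, u ≠ w ∧ G.dist v u = 2 ∧ G.dist v w = 2

/-- The disjunctive domination number of a finite graph: the minimum cardinality of a disjunctive
dominating set (the set of all vertices is one). -/
noncomputable def disjunctiveDominationNumber {V : Type*} (G : SimpleGraph V) : ℕ :=
  sInf {m | ∃ S : Set V, IsDisjunctiveDominating G S ∧ S.ncard = m}

/-- The number of vertices of degree `2` of a finite graph. -/
noncomputable def numDegreeTwo {V : Type*} (G : SimpleGraph V) : ℕ :=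
  {v | (G.neighborSet v).ncard = 2}.ncard

end DisjDom

/-!
A maximal outerplanar graph is a triangulated polygon, and the upper bound is a statement about an
optimal dynamic program on the dual tree of the triangulation.

*From the embedding to a tree.* Starting at an edge `xy` of the outer cycle, enter the triangle
behind it, then the triangles behind its two other sides, and so on. A maximal such unfolding into
pairwise distinct faces, a binary tree, reaches all inner faces, because the inner faces around
each vertex follow one another across inner edges (`PlaneEmbedding.mem_of_closed`). Euler's formula
gives exactly `2 * n - 3` edges and at most `n - 2` inner faces (`PlaneEmbedding.count`). The tree
therefore has too few nodes for any vertex to occur twice, so that it encodes a triangulated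
polygon (`exists_isTriangulated`). This polygon has all the edges of the graph, hence its ears have
degree two (`le_numDegreeTwo`).

*The dynamic program.* A polygon on an edge `xy` meets the rest of the graph in `x` and `y` only.
What matters about a choice of inner vertices is a `Summary` of bounded size: which of `x` and `y`
are chosen, what is offered to the outside, and what is needed from it. Summaries on two sides of a
triangle combine to a summary on the third side (`Realizes.comp`). The smallest costs of the
summaries, compared with two ninths of the number of inner vertices and ears, form a profile, and
`Profile.table` is a finite list of profiles, closed under combination up to domination. By
induction every polygon fits one of them (`exists_fits`). The only failures of the bound occur with
six vertices; for this reason profiles record the number of inner vertices up to five. That the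
table is closed, and that it implies the bound from seven vertices on, is a finite computation
(`Profile.table_check`).

*Sharpness.* In the square of the path on seven vertices no vertex is adjacent to all others, so at
least two vertices are needed, and there are two vertices of degree two.
-/

namespace DisjDom

/-! ### Partial solutions and their summaries -/

/-- `AtLeast k S P`: the finite set `S` has at least `k` elements with the property `P`. -/
def AtLeast {V : Type*} (k : ℕ) (S : Finset V) (P : V → Prop) : Prop :=
  ∃ B ⊆ S, k ≤ B.card ∧ ∀ p ∈ B, P p

theorem AtLeast.zero {V : Type*} (S : Finset V) (P : V → Prop) : AtLeast 0 S P :=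
  ⟨∅, by simp, by simp, by simp⟩

theorem AtLeast.mono {V : Type*} {j k : ℕ} {S T : Finset V} {P Q : V → Prop}
    (h : AtLeast k S P) (hjk : j ≤ k) (hST : S ⊆ T) (hPQ : ∀ p, P p → Q p) : AtLeast j T Q := by
  obtain ⟨B, hB, hk, hP⟩ := h
  exact ⟨B, hB.trans hST, hjk.trans hk, fun p hp => hPQ p (hP p hp)⟩

theorem AtLeast.add {V : Type*} [DecidableEq V] {j k : ℕ} {S T : Finset V} {P : V → Prop}
    (h : AtLeast j S P) (h' : AtLeast k T P) (hd : Disjoint S T) : AtLeast (j + k) (S ∪ T) P := by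
  obtain ⟨B, hB, hj, hP⟩ := h
  obtain ⟨C, hC, hk, hQ⟩ := h'
  refine ⟨B ∪ C, Finset.union_subset_union hB hC, ?_, ?_⟩
  · rw [Finset.card_union_of_disjoint (Finset.disjoint_of_subset_left hB
      (Finset.disjoint_of_subset_right hC hd))]
    omega
  · intro p hp
    rcases Finset.mem_union.1 hp with hp | hp
    exacts [hP p hp, hQ p hp]

theorem AtLeast.toNat {V : Type*} {c : Bool} {S : Finset V} {P : V → Prop}
    (h : c = true → ∃ p ∈ S, P p) : AtLeast c.toNat S P := by
  cases c with
  | false => exact AtLeast.zero S P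
  | true =>
    obtain ⟨p, hp, hP⟩ := h rfl
    exact ⟨{p}, by simpa using hp, by simp, by simpa using hP⟩

/-- There is a walk of length one or two from `v` to `p`. -/
def Near {V : Type*} (G : SimpleGraph V) (v p : V) : Prop :=
  G.Adj v p ∨ ∃ m, G.Adj v m ∧ G.Adj m p

/-- `PartDom G S v k`: the vertex `v` is in `S`, or has a neighbour in `S`, or has at least `k`
vertices of `S` near it. For `k = 2` this says that `S` dominates `v` disjunctively; for smaller
`k` it records how much of the third alternative is already there. -/
def PartDom {V : Type*} (G : SimpleGraph V) (S : Finset V) (v : V) (k : ℕ) : Prop :=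
  v ∈ S ∨ (∃ p ∈ S, G.Adj v p) ∨ AtLeast k S (Near G v)

theorem PartDom.mono {V : Type*} {G : SimpleGraph V} {S T : Finset V} {v : V} {j k : ℕ}
    (h : PartDom G S v k) (hST : S ⊆ T) (hjk : j ≤ k) : PartDom G T v j := by
  rcases h with h | ⟨p, hp, h⟩ | h
  · exact Or.inl (hST h)
  · exact Or.inr (Or.inl ⟨p, hST hp, h⟩)
  · exact Or.inr (Or.inr (h.mono hjk hST fun _ => id))

theorem PartDom.add {V : Type*} [DecidableEq V] {G : SimpleGraph V} {S T : Finset V} {v : V}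
    {j k : ℕ} (h : PartDom G S v j) (h' : AtLeast k T (Near G v)) (hd : Disjoint S T) :
    PartDom G (S ∪ T) v (j + k) := by
  rcases h with h | ⟨p, hp, h⟩ | h
  · exact Or.inl (Finset.mem_union_left _ h)
  · exact Or.inr (Or.inl ⟨p, Finset.mem_union_left _ hp, h⟩)
  · exact Or.inr (Or.inr (h.add h' hd))

/-- The singleton of `x` if `c` is true, and the empty set otherwise. -/
def pick {V : Type*} (c : Bool) (x : V) : Finset V :=
  if c then {x} else ∅

theorem mem_pick {V : Type*} {c : Bool} {x p : V} : p ∈ pick c x ↔ c = true ∧ p = x := by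
  cases c <;> simp [pick]

theorem card_pick {V : Type*} (c : Bool) (x : V) : (pick c x).card = c.toNat := by
  cases c <;> simp [pick]

/-- The set of those endpoints of the edge `xy` that are chosen, according to `u` and `v`. -/
def chosenEnds {V : Type*} [DecidableEq V] (x y : V) (u v : Bool) : Finset V :=
  pick u x ∪ pick v y

/-- What the rest of the graph has to know about a partial solution on a polygon that is attached
to it along the edge `xy` only. All fields but `u` and `v` are guarantees and need not be tight: the
fields `a`, `b`, `un`, `cu`, `cv` bound from below what is offered, and `ru`, `rv`, `rw` bound from
above what is needed. -/
structure Summary where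
  /-- Whether `x` is chosen. -/
  u : Bool
  /-- Whether `y` is chosen. -/
  v : Bool
  /-- If true, `x` has a chosen neighbour inside the polygon. -/
  a : Bool
  /-- If true, `y` has a chosen neighbour inside the polygon. -/
  b : Bool
  /-- A lower bound for the number of chosen inner vertices adjacent to `x` or to `y`. -/
  un : ℕ
  /-- The domination of `x` from the polygon and the edge, in the sense of `PartDom`. -/
  cu : ℕ
  /-- The domination of `y` from the polygon and the edge, in the sense of `PartDom`. -/
  cv : ℕ
  /-- The number of chosen neighbours that `x` needs outside. -/
  ru : ℕ
  /-- The number of chosen neighbours that `y` needs outside. -/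
  rv : ℕ
  /-- The number of chosen vertices needed outside that are adjacent to `x` or to `y`. -/
  rw : ℕ

namespace Summary

/-- The summary of an edge without a polygon behind it. -/
def edge (u v : Bool) : Summary :=
  let c := if u || v then 2 else 0
  ⟨u, v, false, false, 0, c, c, 0, 0, 0⟩

/-- Partial solutions with summaries `s` on the edge `xz` and `t` on the edge `zy` can be combined
across the triangle `xzy`: they agree on whether `z` is chosen, and each gives `z` the chosen
neighbours that the other one needs. -/
def compatible (z : Bool) (s t : Summary) : Bool :=
  s.v == z && t.u == z && Nat.ble s.rv (t.a.toNat + t.v.toNat) &&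
    Nat.ble t.ru (s.b.toNat + s.u.toNat)

/-- The summary on the edge `xy` of the combination of partial solutions with the summaries `s` on
the edge `xz` and `t` on the edge `zy`. -/
def comp (z : Bool) (s t : Summary) : Summary where
  u := s.u
  v := t.v
  a := s.a || z
  b := t.b || z
  un := s.a.toNat + t.b.toNat + z.toNat
  cu := if s.u || t.v || s.a || z then 2 else s.cu + t.un
  cv := if s.u || t.v || t.b || z then 2 else t.cv + s.un
  ru := max (s.ru - t.v.toNat) (s.rw - t.a.toNat - t.v.toNat)
  rv := max (t.rv - s.u.toNat) (t.rw - s.b.toNat - s.u.toNat)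
  rw := if z || s.u || t.v || s.b || t.a then 0 else 2 - s.cv - t.cu

/-- The summary `s` promises at least as much as `t`, and needs at most as much. -/
def implies (s t : Summary) : Bool :=
  s.u == t.u && s.v == t.v && (s.a || !t.a) && (s.b || !t.b) && Nat.ble t.un s.un &&
    Nat.ble t.cu s.cu && Nat.ble t.cv s.cv && Nat.ble s.ru t.ru && Nat.ble s.rv t.rv &&
    (Nat.ble s.rw t.ru || Nat.ble s.rw t.rv || Nat.ble s.rw t.rw)

/-- Nothing is needed from outside, and both ends of the edge are dominated. -/
def closed (s : Summary) : Bool :=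
  Nat.beq s.ru 0 && Nat.beq s.rv 0 && Nat.beq s.rw 0 && Nat.ble 2 s.cu && Nat.ble 2 s.cv

end Summary

/-- The set `A` of inner vertices, in a polygon on the edge `xy` with the set `T` of inner
vertices, is a partial solution with summary `σ`. By `req`, every larger set `S` that supplies
what is needed from outside dominates all inner vertices. -/
structure Realizes {V : Type*} [DecidableEq V] (G : SimpleGraph V) (x y : V) (T : Finset V)
    (σ : Summary) (A : Finset V) : Prop where
  sub : A ⊆ T
  a : σ.a = true → ∃ p ∈ A, G.Adj x p
  b : σ.b = true → ∃ p ∈ A, G.Adj y p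
  un : AtLeast σ.un A (fun p => G.Adj x p ∨ G.Adj y p)
  cu : PartDom G (A ∪ chosenEnds x y σ.u σ.v) x σ.cu
  cv : PartDom G (A ∪ chosenEnds x y σ.u σ.v) y σ.cv
  req : ∀ S, A ∪ chosenEnds x y σ.u σ.v ⊆ S →
    AtLeast σ.ru (S \ (A ∪ chosenEnds x y σ.u σ.v)) (G.Adj x) →
    AtLeast σ.rv (S \ (A ∪ chosenEnds x y σ.u σ.v)) (G.Adj y) →
    AtLeast σ.rw (S \ (A ∪ chosenEnds x y σ.u σ.v)) (fun p => G.Adj x p ∨ G.Adj y p) →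
    ∀ q ∈ T, PartDom G S q 2

theorem Realizes.of_implies {V : Type*} [DecidableEq V] {G : SimpleGraph V} {x y : V}
    {T A : Finset V} {s t : Summary} (h : Realizes G x y T s A) (hst : s.implies t = true) :
    Realizes G x y T t A := by
  obtain ⟨u, v, a, b, un, cu, cv, ru, rv, rw⟩ := s
  obtain ⟨u', v', a', b', un', cu', cv', ru', rv', rw'⟩ := t
  simp only [Summary.implies, Bool.and_eq_true, Bool.or_eq_true, beq_iff_eq, Nat.ble_eq,
    Bool.not_eq_true'] at hst
  obtain ⟨⟨⟨⟨⟨⟨⟨⟨⟨rfl, rfl⟩, ha⟩, hb⟩, hun⟩, hcu⟩, hcv⟩, hru⟩, hrv⟩, hrw⟩ := hst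
  refine ⟨h.sub, fun h' => h.a ?_, fun h' => h.b ?_, h.un.mono hun subset_rfl fun _ => id,
    h.cu.mono subset_rfl hcu, h.cv.mono subset_rfl hcv, fun S hS h1 h2 h3 => ?_⟩
  · simp_all
  · simp_all
  · refine h.req S hS (h1.mono hru subset_rfl fun _ => id) (h2.mono hrv subset_rfl fun _ => id) ?_
    rcases hrw with (hr | hr) | hr
    · exact h1.mono hr subset_rfl fun _ => Or.inl
    · exact h2.mono hr subset_rfl fun _ => Or.inr
    · exact h3.mono hr subset_rfl fun _ => id

theorem realizes_edge {V : Type*} [DecidableEq V] {G : SimpleGraph V} {x y : V} (hxy : G.Adj x y)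
    (u v : Bool) : Realizes G x y ∅ (Summary.edge u v) ∅ := by
  refine ⟨subset_rfl, by simp [Summary.edge], by simp [Summary.edge], AtLeast.zero _ _, ?_, ?_,
    by simp⟩
  · cases u <;> cases v <;>
      simp [Summary.edge, PartDom, chosenEnds, mem_pick, AtLeast.zero, hxy]
  · cases u <;> cases v <;>
      simp [Summary.edge, PartDom, chosenEnds, mem_pick, AtLeast.zero, hxy.symm]

/-! ### Gluing two partial solutions across a triangle -/

set_option maxHeartbeats 1000000 in
/-- Soundness of `Summary.comp`: partial solutions on the edges `xw` and `wy` of a triangle `xwy`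
give one on the edge `xy`. -/
theorem Realizes.comp {V : Type*} [DecidableEq V] {G : SimpleGraph V} {x y w : V}
    {T₁ T₂ A₁ A₂ : Finset V} {s t : Summary} {z : Bool}
    (hxy : G.Adj x y) (hxw : G.Adj x w) (hwy : G.Adj w y) (hT : Disjoint T₁ T₂)
    (hx₁ : x ∉ T₁) (hy₁ : y ∉ T₁) (hw₁ : w ∉ T₁) (hx₂ : x ∉ T₂) (hy₂ : y ∉ T₂) (hw₂ : w ∉ T₂)
    (h₁ : Realizes G x w T₁ s A₁) (h₂ : Realizes G w y T₂ t A₂)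
    (hc : Summary.compatible z s t = true) :
    Realizes G x y (insert w (T₁ ∪ T₂)) (Summary.comp z s t)
      (A₁ ∪ A₂ ∪ pick z w) := by
  simp only [Summary.compatible, Bool.and_eq_true, beq_iff_eq, Nat.ble_eq] at hc
  obtain ⟨⟨⟨hs, ht⟩, hrv⟩, hru⟩ := hc
  have nxy := hxy.ne
  have nxw := hxw.ne
  have nwy := hwy.ne
  have e₁ : A₁ ∪ chosenEnds x w s.u s.v = A₁ ∪ pick s.u x ∪ pick z w := by
    rw [chosenEnds, hs, Finset.union_assoc]
  have e₂ : A₂ ∪ chosenEnds w y t.u t.v = A₂ ∪ pick t.v y ∪ pick z w := by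
    rw [chosenEnds, ht, Finset.union_comm (pick z w), Finset.union_assoc]
  have e₀ : A₁ ∪ A₂ ∪ pick z w ∪ chosenEnds x y s.u t.v =
      A₁ ∪ A₂ ∪ pick z w ∪ pick s.u x ∪ pick t.v y := by
    rw [chosenEnds, Finset.union_assoc _ (pick s.u x)]
  have mW : ∀ p, p ∈ pick z w ↔ z = true ∧ p = w := fun p => mem_pick
  have mX : ∀ p, p ∈ pick s.u x ↔ s.u = true ∧ p = x := fun p => mem_pick
  have mY : ∀ p, p ∈ pick t.v y ↔ t.v = true ∧ p = y := fun p => mem_pick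
  generalize pick z w = W at *
  generalize pick s.u x = X at *
  generalize pick t.v y = Y at *
  obtain ⟨sub₁, a₁, b₁, un₁, cu₁, cv₁, req₁⟩ := h₁
  obtain ⟨sub₂, a₂, b₂, un₂, cu₂, cv₂, req₂⟩ := h₂
  rw [e₁] at cu₁ cv₁ req₁
  rw [e₂] at cu₂ cv₂ req₂
  have i₁ : A₁ ∪ X ∪ W ⊆ A₁ ∪ A₂ ∪ W ∪ X ∪ Y := by
    grind
  have i₂ : A₂ ∪ Y ∪ W ⊆ A₁ ∪ A₂ ∪ W ∪ X ∪ Y := by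
    grind
  have n₁ : ∀ p ∈ A₁, p ∉ A₂ ∧ p ≠ x ∧ p ≠ y ∧ p ≠ w := fun p hp =>
    ⟨fun h => Finset.disjoint_left.1 hT (sub₁ hp) (sub₂ h), fun h => hx₁ (h ▸ sub₁ hp),
      fun h => hy₁ (h ▸ sub₁ hp), fun h => hw₁ (h ▸ sub₁ hp)⟩
  have n₂ : ∀ p ∈ A₂, p ∉ A₁ ∧ p ≠ x ∧ p ≠ y ∧ p ≠ w := fun p hp =>
    ⟨fun h => (n₁ p h).1 hp, fun h => hx₂ (h ▸ sub₂ hp),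
      fun h => hy₂ (h ▸ sub₂ hp), fun h => hw₂ (h ▸ sub₂ hp)⟩
  have d₁ : Disjoint (A₁ ∪ X ∪ W) A₂ := by
    rw [Finset.disjoint_right]
    grind
  have d₂ : Disjoint (A₂ ∪ Y ∪ W) A₁ := by
    rw [Finset.disjoint_right]
    grind
  have aY : ∀ {P : V → Prop}, P y → AtLeast t.v.toNat Y P := fun hP =>
    AtLeast.toNat fun h => ⟨y, (mY y).2 ⟨h, rfl⟩, hP⟩
  have aX : ∀ {P : V → Prop}, P x → AtLeast s.u.toNat X P := fun hP =>
    AtLeast.toNat fun h => ⟨x, (mX x).2 ⟨h, rfl⟩, hP⟩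
  refine ⟨?_, ?_, ?_, ?_, ?_, ?_, ?_⟩
  · grind
  · intro h
    rcases Bool.or_eq_true _ _ ▸ h with h | h
    · obtain ⟨p, hp, hp'⟩ := a₁ h
      exact ⟨p, by simp [hp], hp'⟩
    · exact ⟨w, by simp [mW, h], hxw⟩
  · intro h
    rcases Bool.or_eq_true _ _ ▸ h with h | h
    · obtain ⟨p, hp, hp'⟩ := b₂ h
      exact ⟨p, by simp [hp], hp'⟩
    · exact ⟨w, by simp [mW, h], hwy.symm⟩
  · refine AtLeast.add (AtLeast.add ?_ ?_ ?_) ?_ ?_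
    · exact AtLeast.toNat fun h => (a₁ h).imp fun p hp => ⟨hp.1, Or.inl hp.2⟩
    · exact AtLeast.toNat fun h => (b₂ h).imp fun p hp => ⟨hp.1, Or.inr hp.2⟩
    · exact Finset.disjoint_left.2 fun p hp => (n₁ p hp).1
    · exact AtLeast.toNat fun h => ⟨w, (mW w).2 ⟨h, rfl⟩, Or.inl hxw⟩
    · rw [Finset.disjoint_right]
      intro p hp hp'
      rcases Finset.mem_union.1 hp' with h | h
      · exact (n₁ p h).2.2.2 ((mW p).1 hp).2
      · exact (n₂ p h).2.2.2 ((mW p).1 hp).2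
  · change PartDom G (A₁ ∪ A₂ ∪ W ∪ chosenEnds x y s.u t.v) x _
    rw [e₀]
    by_cases hu : s.u = true
    · exact Or.inl (by simp [mX, hu])
    by_cases hv : t.v = true
    · exact Or.inr (Or.inl ⟨y, by simp [mY, hv], hxy⟩)
    by_cases ha : s.a = true
    · obtain ⟨p, hp, hp'⟩ := a₁ ha
      exact Or.inr (Or.inl ⟨p, by simp [hp], hp'⟩)
    by_cases hz : z = true
    · exact Or.inr (Or.inl ⟨w, by simp [mW, hz], hxw⟩)
    refine (PartDom.add cu₁ (un₂.mono le_rfl subset_rfl ?_) d₁).mono ?_ ?_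
    · rintro p (hp | hp)
      exacts [Or.inr ⟨w, hxw, hp⟩, Or.inr ⟨y, hxy, hp⟩]
    · grind
    · simp [Summary.comp, hu, hv, ha, hz]
  · change PartDom G (A₁ ∪ A₂ ∪ W ∪ chosenEnds x y s.u t.v) y _
    rw [e₀]
    by_cases hv : t.v = true
    · exact Or.inl (by simp [mY, hv])
    by_cases hu : s.u = true
    · exact Or.inr (Or.inl ⟨x, by simp [mX, hu], hxy.symm⟩)
    by_cases hb : t.b = true
    · obtain ⟨p, hp, hp'⟩ := b₂ hb
      exact Or.inr (Or.inl ⟨p, by simp [hp], hp'⟩)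
    by_cases hz : z = true
    · exact Or.inr (Or.inl ⟨w, by simp [mW, hz], hwy.symm⟩)
    refine (PartDom.add cv₂ (un₁.mono le_rfl subset_rfl ?_) d₂).mono ?_ ?_
    · rintro p (hp | hp)
      exacts [Or.inr ⟨x, hxy.symm, hp⟩, Or.inr ⟨w, hwy.symm, hp⟩]
    · grind
    · simp [Summary.comp, hu, hv, hb, hz]
  · intro S hS hru' hrv' hrw'
    change A₁ ∪ A₂ ∪ W ∪ chosenEnds x y s.u t.v ⊆ S at hS
    change AtLeast _ (S \ (A₁ ∪ A₂ ∪ W ∪ chosenEnds x y s.u t.v)) _ at hru'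
    change AtLeast _ (S \ (A₁ ∪ A₂ ∪ W ∪ chosenEnds x y s.u t.v)) _ at hrv'
    change AtLeast _ (S \ (A₁ ∪ A₂ ∪ W ∪ chosenEnds x y s.u t.v)) _ at hrw'
    rw [e₀] at hS hru' hrv' hrw'
    set O := S \ (A₁ ∪ A₂ ∪ W ∪ X ∪ Y) with hO
    have mO : ∀ p, p ∈ O → p ∈ S ∧ p ∉ A₁ ∧ p ∉ A₂ ∧ p ∉ W ∧ p ∉ X ∧ p ∉ Y := by
      grind
    have sA₁ : ∀ p ∈ A₁, p ∈ S := fun p hp => hS (by simp [hp])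
    have sA₂ : ∀ p ∈ A₂, p ∈ S := fun p hp => hS (by simp [hp])
    have sX : ∀ p ∈ X, p ∈ S := fun p hp => hS (by simp [hp])
    have sY : ∀ p ∈ Y, p ∈ S := fun p hp => hS (by simp [hp])
    have sW : ∀ p ∈ W, p ∈ S := fun p hp => hS (by simp [hp])
    have dOY : Disjoint O Y := Finset.disjoint_left.2 fun p hp => (mO p hp).2.2.2.2.2
    have dOX : Disjoint O X := Finset.disjoint_left.2 fun p hp => (mO p hp).2.2.2.2.1
    have dOA₁ : Disjoint O A₁ := Finset.disjoint_left.2 fun p hp => (mO p hp).2.1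
    have dOA₂ : Disjoint O A₂ := Finset.disjoint_left.2 fun p hp => (mO p hp).2.2.1
    have dA₂Y : Disjoint A₂ Y := Finset.disjoint_left.2 fun p hp h =>
      (n₂ p hp).2.2.1 ((mY p).1 h).2
    have dA₁X : Disjoint A₁ X := Finset.disjoint_left.2 fun p hp h =>
      (n₁ p hp).2.1 ((mX p).1 h).2
    -- What the first polygon sees outside itself: `O`, the second polygon and `y`.
    have o₁ : O ∪ A₂ ∪ Y ⊆ S \ (A₁ ∪ X ∪ W) := by grind
    have o₂ : O ∪ A₁ ∪ X ⊆ S \ (A₂ ∪ Y ∪ W) := by grind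
    have r₁ : ∀ q ∈ T₁, PartDom G S q 2 := by
      refine req₁ S (i₁.trans hS) ?_ ?_ ?_
      · refine ((hru'.mono (le_max_left _ _) subset_rfl fun _ => id).add (aY hxy) dOY).mono
          (by omega) (subset_trans ?_ o₁) fun _ => id
        grind
      · refine ((AtLeast.toNat a₂).add (aY hwy) dA₂Y).mono hrv (subset_trans ?_ o₁) fun _ => id
        grind
      · refine (((hru'.mono (le_max_right _ _) subset_rfl fun _ => Or.inl).add
          ((AtLeast.toNat a₂).mono le_rfl subset_rfl fun _ => Or.inr) dOA₂).add
          (aY (Or.inl hxy)) (Finset.disjoint_union_left.2 ⟨dOY, dA₂Y⟩)).mono (by omega) o₁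
          fun _ => id
    have r₂ : ∀ q ∈ T₂, PartDom G S q 2 := by
      refine req₂ S (i₂.trans hS) ?_ ?_ ?_
      · refine ((AtLeast.toNat b₁).add (aX hxw.symm) dA₁X).mono hru (subset_trans ?_ o₂) fun _ => id
        grind
      · refine ((hrv'.mono (le_max_left _ _) subset_rfl fun _ => id).add (aX hxy.symm) dOX).mono
          (by omega) (subset_trans ?_ o₂) fun _ => id
        grind
      · refine (((hrv'.mono (le_max_right _ _) subset_rfl fun _ => Or.inr).add
          ((AtLeast.toNat b₁).mono le_rfl subset_rfl fun _ => Or.inl) dOA₁).add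
          (aX (Or.inl hxw.symm)) (Finset.disjoint_union_left.2 ⟨dOX, dA₁X⟩)).mono (by omega) o₂
          fun _ => id
    intro q hq
    rcases Finset.mem_insert.1 hq with rfl | hq
    · by_cases hz : z = true
      · exact Or.inl (sW _ ((mW _).2 ⟨hz, rfl⟩))
      by_cases hu : s.u = true
      · exact Or.inr (Or.inl ⟨x, sX _ ((mX _).2 ⟨hu, rfl⟩), hxw.symm⟩)
      by_cases hv : t.v = true
      · exact Or.inr (Or.inl ⟨y, sY _ ((mY _).2 ⟨hv, rfl⟩), hwy⟩)
      by_cases hb : s.b = true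
      · obtain ⟨p, hp, hp'⟩ := b₁ hb
        exact Or.inr (Or.inl ⟨p, sA₁ p hp, hp'⟩)
      by_cases ha : t.a = true
      · obtain ⟨p, hp, hp'⟩ := a₂ ha
        exact Or.inr (Or.inl ⟨p, sA₂ p hp, hp'⟩)
      have hW0 : W = ∅ := Finset.eq_empty_of_forall_notMem fun p hp => hz ((mW p).1 hp).1
      have hX0 : X = ∅ := Finset.eq_empty_of_forall_notMem fun p hp => hu ((mX p).1 hp).1
      have hY0 : Y = ∅ := Finset.eq_empty_of_forall_notMem fun p hp => hv ((mY p).1 hp).1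
      rw [hW0, hX0, Finset.union_empty, Finset.union_empty] at cv₁
      rw [hW0, hY0, Finset.union_empty, Finset.union_empty] at cu₂
      have hO2 : AtLeast (2 - s.cv - t.cu) O (Near G q) := by
        refine hrw'.mono ?_ subset_rfl ?_
        · simp [Summary.comp, hz, hu, hv, hb, ha]
        · rintro p (hp | hp)
          exacts [Or.inr ⟨x, hxw.symm, hp⟩, Or.inr ⟨y, hwy, hp⟩]
      rcases cv₁ with h | ⟨p, hp, h⟩ | h
      · exact Or.inl (sA₁ _ h)
      · exact Or.inr (Or.inl ⟨p, sA₁ _ hp, h⟩)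
      refine ((cu₂.add h (Finset.disjoint_left.2 fun p hp => (n₂ p hp).1)).add hO2
        (Finset.disjoint_union_left.2 ⟨dOA₂.symm, dOA₁.symm⟩)).mono ?_ (by omega)
      grind
    · rcases Finset.mem_union.1 hq with hq | hq
      exacts [r₁ q hq, r₂ q hq]

/-! ### The table of profiles -/

/-- An upper bound on the costs of partial solutions on a polygon. -/
structure Profile where
  /-- The number of inner vertices of the polygon, where `5` stands for five or more. -/
  size : ℕ
  /-- Summaries that can be realized. The number `w` that comes with a summary says that this can
  be done with `c` chosen inner vertices, `9 * c + 12 ≤ w + 2 * (m + e)`, where `m` is the number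
  of inner vertices of the polygon and `e` the number of its ears. The `12` serves only to keep
  the numbers in the table nonnegative. -/
  costs : List (Summary × ℕ)

namespace Profile

/-- The summaries, with their costs, that arise from two profiles across a triangle. -/
def combine (P Q : Profile) : List (Summary × ℕ) :=
  P.costs.flatMap fun e => Q.costs.flatMap fun f =>
    if Summary.compatible e.1.v e.1 f.1 then
      [(Summary.comp e.1.v e.1 f.1, e.2 + f.2 + 9 * e.1.v.toNat)]
    else []

/-- Two edges without polygons behind them: the apex of the triangle becomes an ear. -/
def bothEmpty (P Q : Profile) : Bool := Nat.beq P.size 0 && Nat.beq Q.size 0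

/-- Every cost in `R` is achieved by the combination `L` of `P` and `Q`. The `14` is made up of `12`
from the normalization and `2` for the new inner vertex; a new ear contributes another `2`. -/
def coveredBy (P Q : Profile) (L : List (Summary × ℕ)) (R : Profile) : Bool :=
  Nat.beq R.size (min (P.size + Q.size + 1) 5) &&
    R.costs.all fun g => L.any fun e =>
      e.1.implies g.1 && Nat.ble e.2 (g.2 + 14 + 2 * (bothEmpty P Q).toNat)

/-- If the combination `L` of `P` and `Q` is the whole graph and there are at least seven vertices,
then it contains a disjunctive dominating set within the bound. The sizes add up to at most `3` if
and only if there are at most six vertices. The `30` is made up of `24` from the normalizations and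
`6` for the three vertices of the triangle; an end of the base edge with no polygon behind its side
of the triangle has degree two and contributes another `2`. -/
def finishes (P Q : Profile) (L : List (Summary × ℕ)) : Bool :=
  Nat.ble (P.size + Q.size) 3 || L.any fun e => e.1.closed &&
    Nat.ble (e.2 + 9 * e.1.u.toNat + 9 * e.1.v.toNat)
      (30 + 2 * (Nat.beq P.size 0).toNat + 2 * (Nat.beq Q.size 0).toNat)

/-- The summaries in which neither end of the edge is chosen. -/
def neither (a b : Bool) (un cu cv ru rv rw : ℕ) : Summary :=
  ⟨false, false, a, b, un, cu, cv, ru, rv, rw⟩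

/-- The summaries in use in which only the left end of the edge is chosen. -/
def left (b : Bool) (rv : ℕ) : Summary := ⟨true, false, false, b, 0, 2, 2, 0, rv, 0⟩

/-- The summaries in use in which only the right end of the edge is chosen. -/
def right (a : Bool) (ru : ℕ) : Summary := ⟨false, true, a, false, 0, 2, 2, ru, 0, 0⟩

/-- The summary in use in which both ends of the edge are chosen. -/
def both : Summary := ⟨true, true, false, false, 0, 2, 2, 0, 0, 0⟩

/-- A finite list of profiles such that every triangulated polygon fits one of them. The first one
belongs to a single edge. The others come from the optimal costs of small polygons, weakened as far
as closure under combination allows. -/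
def table : List Profile := [
  ⟨0, [(neither false false 0 0 0 0 0 0, 12), (right false 0, 12), (left false 0, 12),
      (both, 12)]⟩,
  ⟨1, [(neither false false 0 0 0 0 0 2, 8), (right false 0, 8), (left false 0, 8), (both, 8)]⟩,
  ⟨2, [(neither false false 0 0 0 0 2 0, 6), (neither true true 1 2 2 0 0 0, 15),
      (right false 0, 6), (left false 1, 6), (both, 6)]⟩,
  ⟨2, [(neither false false 0 0 0 2 0 0, 6), (neither true true 1 2 2 0 0 0, 15),
      (right false 1, 6), (left false 0, 6), (both, 6)]⟩,
  ⟨3, [(neither false false 0 0 0 0 2 0, 4), (neither false true 1 1 2 0 0 0, 13),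
      (right false 0, 4), (left false 1, 4), (both, 4)]⟩,
  ⟨3, [(neither false false 0 0 0 2 0 0, 4), (neither true false 1 2 1 0 0 0, 13),
      (right false 1, 4), (left false 0, 4), (both, 4)]⟩,
  ⟨3, [(neither true true 1 2 2 0 0 0, 13), (both, 4)]⟩,
  ⟨4, [(neither false false 0 0 0 0 2 0, 2), (right false 0, 2), (left false 1, 2), (both, 2)]⟩,
  ⟨4, [(neither false false 0 0 0 2 0 0, 2), (right false 1, 2), (left false 0, 2), (both, 2)]⟩,
  ⟨4, [(neither false true 1 1 2 0 0 0, 11), (right true 0, 11), (left true 0, 11), (both, 11)]⟩,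
  ⟨4, [(neither true false 1 2 1 0 0 0, 11), (right true 0, 11), (left true 0, 11), (both, 11)]⟩,
  ⟨4, [(right false 1, 0), (left false 1, 0), (both, 0)]⟩,
  ⟨5, [(neither false false 0 0 1 0 0 1, 7), (right false 0, 7), (left false 0, 7), (both, 7)]⟩,
  ⟨5, [(neither false false 0 1 0 0 0 1, 7), (right false 0, 7), (left false 0, 7), (both, 7)]⟩,
  ⟨5, [(neither false false 0 1 1 0 0 0, 9), (right false 0, 9), (left false 0, 9), (both, 9)]⟩,
  ⟨5, [(neither false false 0 1 1 0 1 0, 7), (right false 0, 7), (left false 0, 7), (both, 7)]⟩,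
  ⟨5, [(neither false false 0 1 1 1 0 0, 7), (right false 0, 7), (left false 0, 7), (both, 7)]⟩,
  ⟨5, [(neither false true 1 1 2 0 0 0, 10), (right true 0, 10), (left true 0, 10), (both, 10)]⟩,
  ⟨5, [(neither false true 1 1 2 0 0 1, 9), (right false 0, 9), (left true 0, 9), (both, 9)]⟩,
  ⟨5, [(neither false true 1 2 2 0 0 0, 12), (right false 0, 3), (left false 1, 3), (both, 3)]⟩,
  ⟨5, [(neither true false 1 2 1 0 0 0, 10), (right true 0, 10), (left true 0, 10), (both, 10)]⟩,
  ⟨5, [(neither true false 1 2 1 0 0 1, 9), (right true 0, 9), (left false 0, 9), (both, 9)]⟩,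
  ⟨5, [(neither true false 1 2 2 0 0 0, 12), (right false 1, 3), (left false 0, 3), (both, 3)]⟩,
  ⟨5, [(neither true true 1 2 2 0 0 0, 12), (right false 0, 3), (both, 3)]⟩,
  ⟨5, [(neither true true 1 2 2 0 0 0, 12), (left false 0, 3), (both, 3)]⟩,
  ⟨5, [(neither true true 2 2 2 0 0 0, 12), (both, 3)]⟩,
  ⟨5, [(right false 0, 5), (left false 0, 5), (both, 5)]⟩,
  ⟨5, [(right false 1, 0), (left false 1, 0), (both, 0)]⟩]

/-- Any two profiles in the table combine to one that is at least as good as a profile in the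
table, and to a solution within the bound if there are at least seven vertices. -/
theorem table_check : (table.all fun P => table.all fun Q =>
    let L := combine P Q
    finishes P Q L && table.any fun R => coveredBy P Q L R) = true := by
  decide +kernel

end Profile

/-! ### Triangulated polygons -/

/-- The apices of the triangles of a triangulated polygon, which is encoded as a binary tree: the
root is the apex of the triangle on the base edge, and the two subtrees are the polygons behind the
two other sides of this triangle. -/
def inner {α : Type*} : BinaryTree α → List α
  | .nil => []
  | .node z l r => z :: (inner l ++ inner r)

/-- The apices of the triangles that have no polygon behind either of their two sides. -/
def ears {α : Type*} : BinaryTree α → List α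
  | .nil => []
  | .node z .nil .nil => [z]
  | .node _ l r => ears l ++ ears r

/-- The tree `t` encodes a triangulated polygon of `G` on the base edge `xy`. -/
def IsTriangulated {V : Type*} (G : SimpleGraph V) : V → V → BinaryTree V → Prop
  | _, _, .nil => True
  | x, y, .node z l r =>
    G.Adj x z ∧ G.Adj z y ∧ IsTriangulated G x z l ∧ IsTriangulated G z y r

theorem inner_eq_nil {α : Type*} {t : BinaryTree α} : inner t = [] ↔ t = .nil := by
  cases t <;> simp [inner]

/-- The facts about the vertices of a polygon that is split by a triangle at its base. -/
theorem nodup_node {V : Type*} {x y z : V} {l r : BinaryTree V}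
    (h : (x :: y :: inner (.node z l r)).Nodup) :
    (x :: z :: inner l).Nodup ∧ (z :: y :: inner r).Nodup ∧ x ≠ y ∧ x ≠ z ∧ z ≠ y ∧
      x ∉ inner l ∧ y ∉ inner l ∧ z ∉ inner l ∧ x ∉ inner r ∧ y ∉ inner r ∧ z ∉ inner r ∧
      ∀ p ∈ inner l, p ∉ inner r := by
  simp only [inner, List.nodup_cons, List.mem_cons, List.mem_append, not_or,
    List.nodup_append] at h ⊢
  obtain ⟨⟨h1, h2, h3, h4⟩, ⟨h5, h6, h7⟩, ⟨h8, h9⟩, h10, h11, h12⟩ := h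
  exact ⟨⟨⟨h2, h3⟩, h8, h10⟩, ⟨⟨Ne.symm h5, h9⟩, h7, h11⟩, h1, h2, Ne.symm h5, h3, h6, h8, h4, h7,
    h9, fun p hp hp' => h12 p hp p hp' rfl⟩

theorem length_ears_node {α : Type*} (z : α) (l r : BinaryTree α) :
    (ears (.node z l r)).length = (ears l).length + (ears r).length +
      (Nat.beq (inner l).length 0 && Nat.beq (inner r).length 0).toNat := by
  cases l <;> cases r <;> simp [ears, inner, Nat.beq]

/-- The costs promised by `P` are met by the polygon `t` on the edge `xy`. -/
def Profile.Fits {V : Type*} [DecidableEq V] (P : Profile) (G : SimpleGraph V) (x y : V)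
    (t : BinaryTree V) : Prop :=
  P.size = min (inner t).length 5 ∧ ∀ e ∈ P.costs, ∃ A,
    Realizes G x y (inner t).toFinset e.1 A ∧
      9 * A.card + 12 ≤ e.2 + 2 * ((inner t).length + (ears t).length)

theorem Profile.Fits.combine {V : Type*} [DecidableEq V] {P Q : Profile} {G : SimpleGraph V}
    {x y z : V} {l r : BinaryTree V} (hP : P.Fits G x z l) (hQ : Q.Fits G z y r)
    (hxy : G.Adj x y) (hxz : G.Adj x z) (hzy : G.Adj z y)
    (hn : (x :: y :: inner (.node z l r)).Nodup) :
    ∀ e ∈ Profile.combine P Q, ∃ A,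
      Realizes G x y (inner (.node z l r)).toFinset e.1 A ∧ 9 * A.card + 24 ≤
        e.2 + 2 * ((inner l).length + (ears l).length + (inner r).length + (ears r).length) := by
  intro e he
  simp only [Profile.combine, List.mem_flatMap] at he
  obtain ⟨s, hs, t, ht, he⟩ := he
  split_ifs at he with hc
  · rw [List.mem_singleton] at he
    subst he
    obtain ⟨A, hA, cA⟩ := hP.2 s hs
    obtain ⟨B, hB, cB⟩ := hQ.2 t ht
    obtain ⟨-, -, -, -, -, hx₁, hy₁, hz₁, hx₂, hy₂, hz₂, hd⟩ := nodup_node hn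
    refine ⟨A ∪ B ∪ pick s.1.v z, ?_, ?_⟩
    · have hd' : Disjoint (inner l).toFinset (inner r).toFinset := by
        rw [Finset.disjoint_left]
        intro p hp hp'
        exact hd p (List.mem_toFinset.1 hp) (List.mem_toFinset.1 hp')
      have := Realizes.comp hxy hxz hzy hd' (by simpa using hx₁) (by simpa using hy₁)
        (by simpa using hz₁) (by simpa using hx₂) (by simpa using hy₂) (by simpa using hz₂)
        hA hB hc
      simpa [inner, List.toFinset_append] using this
    · have h1 := Finset.card_union_le (A ∪ B) (pick s.1.v z)
      have h2 := Finset.card_union_le A B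
      rw [card_pick] at h1
      dsimp only
      omega
  · simp at he

theorem Profile.table_spec {P Q : Profile} (hP : P ∈ table) (hQ : Q ∈ table) :
    finishes P Q (Profile.combine P Q) = true ∧
      ∃ R ∈ table, coveredBy P Q (Profile.combine P Q) R = true := by
  have h := table_check
  rw [List.all_eq_true] at h
  have h := h P hP
  rw [List.all_eq_true] at h
  have h := h Q hQ
  rw [Bool.and_eq_true, List.any_eq_true] at h
  exact h

/-- Every triangulated polygon fits some profile of the table. -/
theorem exists_fits {V : Type*} [DecidableEq V] {G : SimpleGraph V} (t : BinaryTree V) :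
    ∀ {x y : V}, G.Adj x y → IsTriangulated G x y t → (x :: y :: inner t).Nodup →
      ∃ P ∈ Profile.table, P.Fits G x y t := by
  induction t with
  | nil =>
    intro x y hxy _ _
    refine ⟨_, List.mem_cons_self .., by simp [inner], ?_⟩
    intro e he
    refine ⟨∅, ?_, ?_⟩
    · have key : e.1 = Summary.edge e.1.u e.1.v := by
        simp only [List.mem_cons, List.not_mem_nil, or_false] at he
        rcases he with rfl | rfl | rfl | rfl <;> rfl
      rw [key]
      exact realizes_edge hxy _ _
    · simp only [List.mem_cons, List.not_mem_nil, or_false] at he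
      rcases he with rfl | rfl | rfl | rfl <;> simp
  | node z l r hl hr =>
    intro x y hxy ht hn
    obtain ⟨hxz, hzy, tl, tr⟩ := ht
    obtain ⟨nl, nr, -⟩ := nodup_node hn
    obtain ⟨P, hP, fP⟩ := hl hxz tl nl
    obtain ⟨Q, hQ, fQ⟩ := hr hzy tr nr
    obtain ⟨-, R, hR, hc⟩ := Profile.table_spec hP hQ
    have key := fP.combine fQ hxy hxz hzy hn
    rw [Profile.coveredBy, Bool.and_eq_true, List.all_eq_true, Nat.beq_eq] at hc
    refine ⟨R, hR, ?_, ?_⟩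
    · rw [hc.1, fP.1, fQ.1]
      simp only [inner, List.length_cons, List.length_append]
      omega
    · intro g hg
      obtain ⟨e, he, hg⟩ := List.any_eq_true.1 (hc.2 g hg)
      rw [Bool.and_eq_true, Nat.ble_eq] at hg
      obtain ⟨A, hA, cA⟩ := key e he
      refine ⟨A, hA.of_implies hg.1, ?_⟩
      have hb : Profile.bothEmpty P Q =
          (Nat.beq (inner l).length 0 && Nat.beq (inner r).length 0) := by
        rw [Bool.eq_iff_iff]
        simp only [Profile.bothEmpty, Bool.and_eq_true, Nat.beq_eq, fP.1, fQ.1]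
        omega
      rw [length_ears_node, ← hb]
      have := hg.2
      simp only [inner, List.length_cons, List.length_append]
      omega

/-- A triangulated polygon with at least seven vertices has a disjunctive dominating set within the
bound. Besides the ears, the ends of the base edge count if there is no polygon behind the side of
the triangle at this end. -/
theorem exists_partDom {V : Type*} [DecidableEq V] {G : SimpleGraph V} {x y z : V}
    {l r : BinaryTree V} (hxy : G.Adj x y) (ht : IsTriangulated G x y (.node z l r))
    (hn : (x :: y :: inner (.node z l r)).Nodup) (h5 : 5 ≤ (inner (.node z l r)).length) :
    ∃ S : Finset V, (∀ q ∈ x :: y :: inner (.node z l r), PartDom G S q 2) ∧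
      9 * S.card ≤ 2 * ((inner (.node z l r)).length + 2) +
        2 * ((ears (.node z l r)).length +
          (Nat.beq (inner l).length 0).toNat + (Nat.beq (inner r).length 0).toNat) := by
  obtain ⟨hxz, hzy, tl, tr⟩ := ht
  obtain ⟨nl, nr, -⟩ := nodup_node hn
  obtain ⟨P, hP, fP⟩ := exists_fits l hxz tl nl
  obtain ⟨Q, hQ, fQ⟩ := exists_fits r hzy tr nr
  obtain ⟨hf, -⟩ := Profile.table_spec hP hQ
  have bl : Nat.beq P.size 0 = Nat.beq (inner l).length 0 := by
    rw [Bool.eq_iff_iff, Nat.beq_eq, Nat.beq_eq, fP.1]; omega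
  have br : Nat.beq Q.size 0 = Nat.beq (inner r).length 0 := by
    rw [Bool.eq_iff_iff, Nat.beq_eq, Nat.beq_eq, fQ.1]; omega
  rw [length_ears_node]
  simp only [inner, List.length_cons, List.length_append] at h5 ⊢
  rw [Profile.finishes, Bool.or_eq_true, Nat.ble_eq, List.any_eq_true, bl, br] at hf
  rcases hf with hf | ⟨e, he, hf⟩
  · have := fP.1
    have := fQ.1
    omega
  simp only [Bool.and_eq_true, Summary.closed, Nat.ble_eq, Nat.beq_eq] at hf
  obtain ⟨⟨⟨⟨⟨hru, hrv⟩, hrw⟩, hcu⟩, hcv⟩, hw⟩ := hf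
  obtain ⟨A, hA, cA⟩ := fP.combine fQ hxy hxz hzy hn e he
  refine ⟨A ∪ chosenEnds x y e.1.u e.1.v, ?_, ?_⟩
  · intro q hq
    rcases List.mem_cons.1 hq with rfl | hq
    · exact hA.cu.mono subset_rfl hcu
    rcases List.mem_cons.1 hq with rfl | hq
    · exact hA.cv.mono subset_rfl hcv
    refine hA.req _ subset_rfl ?_ ?_ ?_ q (List.mem_toFinset.2 hq)
    · rw [hru]; exact AtLeast.zero _ _
    · rw [hrv]; exact AtLeast.zero _ _
    · rw [hrw]; exact AtLeast.zero _ _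
  · have h1 := Finset.card_union_le A (chosenEnds x y e.1.u e.1.v)
    have h2 := Finset.card_union_le (pick e.1.u x) (pick e.1.v y)
    rw [card_pick, card_pick] at h2
    rw [chosenEnds] at h1 ⊢
    omega

theorem isDisjunctiveDominating_of_partDom {V : Type*} {G : SimpleGraph V} {S : Finset V}
    (h : ∀ v, PartDom G S v 2) : IsDisjunctiveDominating G (S : Set V) := by
  intro v hv
  rcases h v with h | ⟨p, hp, h⟩ | ⟨B, hB, h2, hP⟩
  · exact absurd h hv
  · exact Or.inl ⟨p, hp, h⟩
  · by_cases hadj : ∃ u ∈ (S : Set V), G.Adj v u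
    · exact Or.inl hadj
    · refine Or.inr ?_
      obtain ⟨p, hp, q, hq, hpq⟩ := Finset.one_lt_card.1 (show 1 < B.card by omega)
      have key : ∀ r ∈ B, G.dist v r = 2 := by
        intro r hr
        have hna : ¬ G.Adj v r := fun h => hadj ⟨r, hB hr, h⟩
        have hne : v ≠ r := fun h => hv (h ▸ hB hr)
        obtain ⟨m, h1, h2⟩ := (hP r hr).resolve_left hna
        have hle : G.dist v r ≤ 2 := SimpleGraph.dist_le (.cons h1 (.cons h2 .nil))
        have h0 : G.dist v r ≠ 0 := fun h =>
          hne ((h1.reachable.trans h2.reachable).dist_eq_zero_iff.1 h)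
        have h1' : G.dist v r ≠ 1 := fun h => hna (SimpleGraph.dist_eq_one_iff_adj.1 h)
        omega
      exact ⟨p, hB hp, q, hB hq, hpq, key p hp, key q hq⟩

/-! ### Edges and vertices of degree two of a triangulated polygon -/

theorem ears_sublist_inner {α : Type*} (t : BinaryTree α) : (ears t).Sublist (inner t) := by
  induction t with
  | nil => exact List.Sublist.refl _
  | node z l r hl hr =>
    cases l with
    | nil =>
      cases r with
      | nil => simp [ears, inner]
      | node => exact (hl.append hr).cons _
    | node => exact (hl.append hr).cons _

/-- The edges of a triangulated polygon on the edge `xy`, except for `xy` itself. -/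
def sides {V : Type*} : V → V → BinaryTree V → List (Sym2 V)
  | _, _, .nil => []
  | x, y, .node z l r => s(x, z) :: s(z, y) :: (sides x z l ++ sides z y r)

theorem length_sides {V : Type*} (t : BinaryTree V) :
    ∀ x y, (sides x y t).length = 2 * (inner t).length := by
  induction t with
  | nil => intros; rfl
  | node z l r hl hr =>
    intro x y
    simp only [sides, inner, List.length_cons, List.length_append, hl, hr]
    omega

theorem mem_edgeSet_of_mem_sides {V : Type*} {G : SimpleGraph V} (t : BinaryTree V) :
    ∀ {x y : V}, IsTriangulated G x y t → ∀ e ∈ sides x y t, e ∈ G.edgeSet := by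
  induction t with
  | nil => intro x y _ e he; simp [sides] at he
  | node z l r hl hr =>
    intro x y ⟨h1, h2, h3, h4⟩ e he
    simp only [sides, List.mem_cons, List.mem_append] at he
    rcases he with rfl | rfl | he | he
    exacts [h1, h2, hl h3 e he, hr h4 e he]

theorem exists_mem_inner_of_mem_sides {V : Type*} (t : BinaryTree V) :
    ∀ {x y : V}, ∀ e ∈ sides x y t, ∃ q ∈ inner t, q ∈ e := by
  induction t with
  | nil => intro x y e he; simp [sides] at he
  | node z l r hl hr =>
    intro x y e he
    simp only [sides, List.mem_cons, List.mem_append] at he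
    rcases he with rfl | rfl | he | he
    · exact ⟨z, by simp [inner], by simp⟩
    · exact ⟨z, by simp [inner], by simp⟩
    · obtain ⟨q, hq, hq'⟩ := hl e he
      exact ⟨q, by simp [inner, hq], hq'⟩
    · obtain ⟨q, hq, hq'⟩ := hr e he
      exact ⟨q, by simp [inner, hq], hq'⟩

theorem mem_of_mem_sides {V : Type*} (t : BinaryTree V) :
    ∀ {x y : V}, ∀ e ∈ sides x y t, ∀ q ∈ e, q = x ∨ q = y ∨ q ∈ inner t := by
  induction t with
  | nil => intro x y e he; simp [sides] at he
  | node z l r hl hr =>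
    intro x y e he q hq
    simp only [sides, List.mem_cons, List.mem_append] at he
    simp only [inner, List.mem_cons, List.mem_append]
    rcases he with rfl | rfl | he | he
    · rcases Sym2.mem_iff.1 hq with rfl | rfl <;> simp
    · rcases Sym2.mem_iff.1 hq with rfl | rfl <;> simp
    · rcases hl e he q hq with h | h | h <;> simp [h]
    · rcases hr e he q hq with h | h | h <;> simp [h]

theorem nodup_sides {V : Type*} (t : BinaryTree V) :
    ∀ {x y : V}, (x :: y :: inner t).Nodup → (sides x y t).Nodup := by
  induction t with
  | nil => intro x y _; simp [sides]
  | node z l r hl hr =>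
    intro x y hn
    obtain ⟨nl, nr, hxy, hxz, hzy, hx₁, hy₁, hz₁, hx₂, hy₂, hz₂, hd⟩ := nodup_node hn
    have key : ∀ {a b c d : V} {t : BinaryTree V}, a ∉ inner t → b ∉ inner t →
        s(a, b) ∉ sides c d t := by
      intro a b c d t ha hb h
      obtain ⟨q, hq, hq'⟩ := exists_mem_inner_of_mem_sides t _ h
      rcases Sym2.mem_iff.1 hq' with rfl | rfl
      exacts [ha hq, hb hq]
    simp only [sides, List.nodup_cons, List.mem_cons, List.mem_append, not_or, List.nodup_append]
    refine ⟨⟨?_, key hx₁ hz₁, key hx₂ hz₂⟩, ⟨key hz₁ hy₁, key hz₂ hy₂⟩, hl nl, hr nr, ?_⟩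
    · intro h
      rcases Sym2.eq_iff.1 h with ⟨h, -⟩ | ⟨h, -⟩
      exacts [hxz h, hxy h]
    · rintro e he _ he' rfl
      obtain ⟨q, hq, hqe⟩ := exists_mem_inner_of_mem_sides l e he
      rcases mem_of_mem_sides r e he' q hqe with rfl | rfl | h
      exacts [hz₁ hq, hy₁ hq, hd q hq h]

theorem exists_neighbors_of_mem_ears {V : Type*} (t : BinaryTree V) :
    ∀ {x y : V}, (x :: y :: inner t).Nodup → ∀ q ∈ ears t,
      ∃ a b, a ≠ b ∧ ∀ w, s(q, w) ∈ sides x y t ↔ w = a ∨ w = b := by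
  induction t with
  | nil => intro x y _ q hq; simp [ears] at hq
  | node z l r hl hr =>
    intro x y hn q hq
    obtain ⟨nl, nr, hxy, hxz, hzy, hx₁, hy₁, hz₁, hx₂, hy₂, hz₂, hd⟩ := nodup_node hn
    by_cases hnil : l = .nil ∧ r = .nil
    · obtain ⟨rfl, rfl⟩ := hnil
      simp only [ears, List.mem_singleton] at hq
      subst hq
      refine ⟨x, y, hxy, fun w => ?_⟩
      simp only [sides, List.append_nil, List.mem_cons, List.not_mem_nil, or_false, Sym2.eq_iff]
      constructor
      · rintro ((⟨h, -⟩ | ⟨-, h⟩) | (⟨-, h⟩ | ⟨h, -⟩))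
        exacts [absurd h.symm hxz, Or.inl h, Or.inr h, absurd h hzy]
      · rintro (rfl | rfl) <;> simp
    · have he : ears (.node z l r) = ears l ++ ears r := by
        cases l <;> cases r <;> first | rfl | simp at hnil
      rw [he, List.mem_append] at hq
      rcases hq with hq | hq
      · obtain ⟨a, b, hab, h⟩ := hl nl q hq
        refine ⟨a, b, hab, fun w => ?_⟩
        have hq := (ears_sublist_inner l).subset hq
        rw [← h w]
        simp only [sides, List.mem_cons, List.mem_append, Sym2.eq_iff]
        constructor
        · rintro ((⟨rfl, -⟩ | ⟨rfl, -⟩) | (⟨rfl, -⟩ | ⟨rfl, -⟩) | h | h)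
          · exact absurd hq hx₁
          · exact absurd hq hz₁
          · exact absurd hq hz₁
          · exact absurd hq hy₁
          · exact h
          · rcases mem_of_mem_sides r _ h q (by simp) with rfl | rfl | h
            exacts [absurd hq hz₁, absurd hq hy₁, absurd h (hd q hq)]
        · exact fun h => Or.inr (Or.inr (Or.inl h))
      · obtain ⟨a, b, hab, h⟩ := hr nr q hq
        refine ⟨a, b, hab, fun w => ?_⟩
        have hq := (ears_sublist_inner r).subset hq
        rw [← h w]
        simp only [sides, List.mem_cons, List.mem_append, Sym2.eq_iff]
        constructor
        · rintro ((⟨rfl, -⟩ | ⟨rfl, -⟩) | (⟨rfl, -⟩ | ⟨rfl, -⟩) | h | h)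
          · exact absurd hq hx₂
          · exact absurd hq hz₂
          · exact absurd hq hz₂
          · exact absurd hq hy₂
          · rcases mem_of_mem_sides l _ h q (by simp) with rfl | rfl | h
            exacts [absurd hq hx₂, absurd hq hz₂, absurd hq (hd q h)]
          · exact h
        · exact fun h => Or.inr (Or.inr (Or.inr h))

/-- If the triangulated polygon has all vertices and as many edges as `G`, then its ears, and the
ends of the base edge without a polygon behind their side, have degree two in `G`. -/
theorem le_numDegreeTwo {V : Type*} [Finite V] {G : SimpleGraph V} {x y z : V}
    {l r : BinaryTree V} (hxy : G.Adj x y) (ht : IsTriangulated G x y (.node z l r))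
    (hn : (x :: y :: inner (.node z l r)).Nodup)
    (hm : G.edgeSet.ncard ≤ 2 * (inner (.node z l r)).length + 1) :
    (ears (.node z l r)).length + (Nat.beq (inner l).length 0).toNat +
      (Nat.beq (inner r).length 0).toNat ≤ numDegreeTwo G := by
  classical
  obtain ⟨nl, nr, hxy', hxz, hzy, hx₁, hy₁, hz₁, hx₂, hy₂, hz₂, hd⟩ := nodup_node hn
  set t : BinaryTree V := .node z l r with htdef
  have hxt : x ∉ inner t := by
    have := (List.nodup_cons.1 hn).1; simp at this; exact this.2
  have hyt : y ∉ inner t := (List.nodup_cons.1 (List.nodup_cons.1 hn).2).1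
  have hnd : (s(x, y) :: sides x y t).Nodup := by
    refine List.nodup_cons.2 ⟨fun h => ?_, nodup_sides t hn⟩
    obtain ⟨q, hq, hq'⟩ := exists_mem_inner_of_mem_sides t _ h
    rcases Sym2.mem_iff.1 hq' with rfl | rfl
    exacts [hxt hq, hyt hq]
  have hsub : ((s(x, y) :: sides x y t).toFinset : Set (Sym2 V)) ⊆ G.edgeSet := by
    intro e he
    rcases List.mem_cons.1 (List.mem_toFinset.1 (Finset.mem_coe.1 he)) with rfl | he
    exacts [hxy, mem_edgeSet_of_mem_sides t ht e he]
  have heq : ((s(x, y) :: sides x y t).toFinset : Set (Sym2 V)) = G.edgeSet := by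
    refine Set.eq_of_subset_of_ncard_le hsub ?_ (Set.toFinite _)
    rw [Set.ncard_coe_finset, List.toFinset_card_of_nodup hnd, List.length_cons, length_sides]
    exact hm
  have hadj : ∀ a b, G.Adj a b ↔ s(a, b) = s(x, y) ∨ s(a, b) ∈ sides x y t := by
    intro a b
    rw [← SimpleGraph.mem_edgeSet, ← heq]
    simp
  have hdeg : ∀ q, (∃ a b, a ≠ b ∧ ∀ w, G.Adj q w ↔ w = a ∨ w = b) →
      q ∈ {v | (G.neighborSet v).ncard = 2} := by
    rintro q ⟨a, b, hab, h⟩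
    have : G.neighborSet q = {a, b} := by
      ext w; simp [h]
    rw [Set.mem_ofPred_eq, this, Set.ncard_pair hab]
  have hears : ∀ q ∈ ears t, q ∈ {v | (G.neighborSet v).ncard = 2} := by
    intro q hq
    obtain ⟨a, b, hab, h⟩ := exists_neighbors_of_mem_ears t hn q hq
    refine hdeg q ⟨a, b, hab, fun w => ?_⟩
    rw [hadj, ← h, or_iff_right]
    intro h'
    have hq := (ears_sublist_inner t).subset hq
    rcases Sym2.eq_iff.1 h' with ⟨rfl, -⟩ | ⟨rfl, -⟩
    exacts [hxt hq, hyt hq]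
  have hx : l = .nil → x ∈ {v | (G.neighborSet v).ncard = 2} := by
    rintro rfl
    refine hdeg x ⟨y, z, hzy.symm, fun w => ?_⟩
    rw [hadj]
    simp only [htdef, sides, List.nil_append, List.mem_cons, Sym2.eq_iff]
    constructor
    · rintro ((⟨-, h⟩ | ⟨h, -⟩) | (⟨-, h⟩ | ⟨h, -⟩) | (⟨h, -⟩ | ⟨h, -⟩) | h)
      · exact Or.inl h
      · exact absurd h hxy'
      · exact Or.inr h
      · exact absurd h hxz
      · exact absurd h hxz
      · exact absurd h hxy'
      · rcases mem_of_mem_sides r _ h x (by simp) with h | h | h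
        exacts [absurd h hxz, absurd h hxy', absurd h hx₂]
    · rintro (rfl | rfl) <;> simp
  have hy : r = .nil → y ∈ {v | (G.neighborSet v).ncard = 2} := by
    rintro rfl
    refine hdeg y ⟨x, z, hxz, fun w => ?_⟩
    rw [hadj]
    simp only [htdef, sides, List.append_nil, List.mem_cons, Sym2.eq_iff]
    constructor
    · rintro ((⟨h, -⟩ | ⟨-, h⟩) | (⟨h, -⟩ | ⟨h, -⟩) | (⟨h, -⟩ | ⟨-, h⟩) | h)
      · exact absurd h.symm hxy'
      · exact Or.inl h
      · exact absurd h.symm hxy'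
      · exact absurd h.symm hzy
      · exact absurd h.symm hzy
      · exact Or.inr h
      · rcases mem_of_mem_sides l _ h y (by simp) with h | h | h
        exacts [absurd h.symm hxy', absurd h.symm hzy, absurd h hy₁]
    · rintro (rfl | rfl) <;> simp
  have hnil : ∀ s : BinaryTree V, Nat.beq (inner s).length 0 = true ↔ s = .nil := by
    intro s
    rw [Nat.beq_eq, List.length_eq_zero_iff, inner_eq_nil]
  set D : Finset V := (ears t).toFinset ∪ (pick (Nat.beq (inner l).length 0) x ∪
    pick (Nat.beq (inner r).length 0) y) with hD
  have hDsub : (D : Set V) ⊆ {v | (G.neighborSet v).ncard = 2} := by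
    intro q hq
    simp only [hD, Finset.coe_union, Set.mem_union, Finset.mem_coe, List.mem_toFinset, mem_pick,
      hnil] at hq
    rcases hq with hq | ⟨h, rfl⟩ | ⟨h, rfl⟩
    exacts [hears q hq, hx h, hy h]
  have hcard : D.card = (ears t).length + (Nat.beq (inner l).length 0).toNat +
      (Nat.beq (inner r).length 0).toNat := by
    rw [hD, Finset.card_union_of_disjoint, Finset.card_union_of_disjoint, card_pick, card_pick,
      List.toFinset_card_of_nodup, add_assoc]
    · exact (ears_sublist_inner t).nodup (List.nodup_cons.1 (List.nodup_cons.1 hn).2).2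
    · rw [Finset.disjoint_left]
      intro p hp hp'
      exact hxy' ((mem_pick.1 hp).2.symm.trans (mem_pick.1 hp').2)
    · rw [Finset.disjoint_left]
      intro p hp hp'
      have hp := (ears_sublist_inner t).subset (List.mem_toFinset.1 hp)
      rcases Finset.mem_union.1 hp' with h | h
      · exact hxt ((mem_pick.1 h).2 ▸ hp)
      · exact hyt ((mem_pick.1 h).2 ▸ hp)
  rw [← hcard, ← Set.ncard_coe_finset, numDegreeTwo]
  exact Set.ncard_le_ncard hDsub (Set.toFinite _)

/-! ### Faces of a plane embedding with triangular inner faces -/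

namespace PlaneEmbedding

theorem facePerm_fst {V : Type*} {G : SimpleGraph V} (M : PlaneEmbedding G) (d : G.Dart) :
    (M.facePerm d).fst = d.snd :=
  M.rot_fst d.symm

theorem mem_outerFace_facePerm {V : Type*} {G : SimpleGraph V} (M : PlaneEmbedding G)
    {d : G.Dart} : M.facePerm d ∈ M.outerFace ↔ d ∈ M.outerFace :=
  Equiv.Perm.sameCycle_apply_right

/-- The face of `d` has at most `k` darts if its boundary walk closes up after `k` steps. -/
theorem ncard_face_le {V : Type*} [Finite V] {G : SimpleGraph V} (M : PlaneEmbedding G)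
    {d : G.Dart} {k : ℕ} (hk : 0 < k) (h : (M.facePerm ^ k) d = d) : (M.face d).ncard ≤ k := by
  classical
  have hfin : Finite G.Dart := Finite.of_injective _ (SimpleGraph.Dart.toProd_injective (G := G))
  have hsub : M.face d ⊆ ((Finset.range k).image fun i => (M.facePerm ^ i) d : Finset G.Dart) := by
    intro e he
    obtain ⟨n, hn⟩ := Equiv.Perm.SameCycle.exists_nat_pow_eq (show M.facePerm.SameCycle d e from he)
    have hper : ∀ m, ((M.facePerm ^ k) ^ m) d = d := by
      intro m
      induction m with
      | zero => rfl
      | succ m ih => rw [pow_succ, Equiv.Perm.mul_apply, h, ih]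
    refine Finset.mem_coe.2 (Finset.mem_image.2 ⟨n % k, Finset.mem_range.2 (Nat.mod_lt _ hk), ?_⟩)
    rw [← hn]
    conv_rhs => rw [← Nat.mod_add_div n k, pow_add, Equiv.Perm.mul_apply, pow_mul, hper]
  refine (Set.ncard_le_ncard hsub (Finset.finite_toSet _)).trans ?_
  rw [Set.ncard_coe_finset]
  exact Finset.card_image_le.trans (by simp)

theorem face_eq {V : Type*} [Finite V] {G : SimpleGraph V} (M : PlaneEmbedding G) {d : G.Dart}
    (h : (M.face d).ncard = 3) :
    M.face d = {d, M.facePerm d, M.facePerm (M.facePerm d)} ∧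
      M.facePerm (M.facePerm (M.facePerm d)) = d := by
  have hfin : Finite G.Dart := Finite.of_injective _ (SimpleGraph.Dart.toProd_injective (G := G))
  have h1 : M.facePerm d ≠ d := fun h' => by
    have := M.ncard_face_le (d := d) (k := 1) one_pos (by simpa using h')
    omega
  have h2 : M.facePerm (M.facePerm d) ≠ d := fun h' => by
    have := M.ncard_face_le (d := d) (k := 2) two_pos (by simpa [pow_two] using h')
    omega
  have h12 : M.facePerm (M.facePerm d) ≠ M.facePerm d := fun h' => h1 (M.facePerm.injective h')
  have hsub : ({d, M.facePerm d, M.facePerm (M.facePerm d)} : Set G.Dart) ⊆ M.face d := by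
    rintro e (rfl | rfl | rfl)
    · exact Equiv.Perm.SameCycle.refl _ _
    · exact Equiv.Perm.sameCycle_apply_right.2 (Equiv.Perm.SameCycle.refl _ _)
    · exact Equiv.Perm.sameCycle_apply_right.2 (Equiv.Perm.sameCycle_apply_right.2
        (Equiv.Perm.SameCycle.refl _ _))
  have heq : ({d, M.facePerm d, M.facePerm (M.facePerm d)} : Set G.Dart) = M.face d := by
    refine Set.eq_of_subset_of_ncard_le hsub ?_ (Set.toFinite _)
    rw [h, Set.ncard_eq_three.2 ⟨_, _, _, h1.symm, h2.symm, h12.symm, rfl⟩]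
  refine ⟨heq.symm, ?_⟩
  have h3 : M.facePerm (M.facePerm (M.facePerm d)) ∈ M.face d := by
    refine Equiv.Perm.sameCycle_apply_right.2 (?_ : M.facePerm (M.facePerm d) ∈ M.face d)
    rw [← heq]
    simp
  rw [← heq] at h3
  rcases h3 with h3 | h3 | h3
  · exact h3
  · exact absurd (M.facePerm.injective h3) h2
  · exact absurd (M.facePerm.injective h3) h12

/-- An edge has an inner face on at least one of its sides. -/
theorem symm_notMem_outerFace {V : Type*} {G : SimpleGraph V} (M : PlaneEmbedding G)
    (h3 : 3 ≤ Nat.card V) (hO : ∀ v : V, ∃! d : G.Dart, d ∈ M.outerFace ∧ d.fst = v)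
    {d : G.Dart} (hd : d ∈ M.outerFace) : d.symm ∉ M.outerFace := by
  intro hs
  -- Otherwise the outer boundary walk goes back and forth along one edge.
  have key : ∀ e : G.Dart, e ∈ M.outerFace → e.symm ∈ M.outerFace → M.facePerm e = e.symm :=
    fun e he hs => (hO e.snd).unique ⟨M.mem_outerFace_facePerm.2 he, M.facePerm_fst e⟩ ⟨hs, rfl⟩
  have h1 := key d hd hs
  have h2 : M.facePerm d.symm = d := by
    simpa using key d.symm hs (by simpa using hd)
  have hall : ∀ i : ℤ, (M.facePerm ^ i) d = d ∨ (M.facePerm ^ i) d = d.symm := by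
    intro i
    induction i with
    | zero => exact Or.inl rfl
    | succ i ih =>
      rw [add_comm, zpow_add, Equiv.Perm.mul_apply, zpow_one]
      rcases ih with ih | ih <;> rw [ih]
      exacts [Or.inr h1, Or.inl h2]
    | pred i ih =>
      rw [sub_eq_add_neg, add_comm, zpow_add, Equiv.Perm.mul_apply, zpow_neg_one]
      rcases ih with ih | ih <;> rw [ih, Equiv.Perm.inv_eq_iff_eq, Equiv.Perm.inv_eq_iff_eq]
      exacts [Or.inr h2.symm, Or.inl h1.symm]
  have hV : (Set.univ : Set V) ⊆ {d.fst, d.snd} := by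
    intro v _
    obtain ⟨e, ⟨he, rfl⟩, -⟩ := hO v
    obtain ⟨i, rfl⟩ := (Equiv.Perm.SameCycle.symm hd).trans he
    rcases hall i with h | h <;> rw [h] <;> simp
  have := Set.ncard_le_ncard hV (Set.toFinite _)
  rw [Set.ncard_univ, Set.ncard_pair d.fst_ne_snd] at this
  omega

/-- The inner faces are connected to each other across the inner edges: a union `F` of faces that
contains an inner face, and with each dart its reverse if this is inner, contains all inner faces.
Around a vertex only one dart is outer, so the inner darts follow one another without a gap; and `G`
is connected. -/
theorem mem_of_closed {V : Type*} [Finite V] {G : SimpleGraph V} (M : PlaneEmbedding G)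
    (h3 : 3 ≤ Nat.card V) (hO : ∀ v : V, ∃! d : G.Dart, d ∈ M.outerFace ∧ d.fst = v)
    {F : Set G.Dart} (hF : ∀ d, M.facePerm d ∈ F ↔ d ∈ F)
    (hsymm : ∀ d ∈ F, d.symm ∉ M.outerFace → d.symm ∈ F)
    {d₀ : G.Dart} (hd₀ : d₀ ∈ F) (hi₀ : d₀ ∉ M.outerFace) :
    ∀ d, d ∉ M.outerFace → d ∈ F := by
  have hfin : Finite G.Dart := Finite.of_injective _ (SimpleGraph.Dart.toProd_injective (G := G))
  have rot_eq : ∀ d, M.rot d = M.facePerm d.symm := fun d => by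
    change M.rot d = M.rot d.symm.symm
    rw [SimpleGraph.Dart.symm_symm]
  have step : ∀ d, d ∉ M.outerFace → M.rot d ∉ M.outerFace → (M.rot d ∈ F ↔ d ∈ F) := by
    intro d hd hr
    rw [rot_eq, hF]
    rw [rot_eq, M.mem_outerFace_facePerm] at hr
    exact ⟨fun h => by simpa using hsymm d.symm h (by simpa using hd), fun h => hsymm d h hr⟩
  -- The darts at `v` in cyclic order, beginning with the outer one `o`.
  have star : ∀ o : G.Dart, o ∈ M.outerFace → ∀ d, d.fst = o.fst → d ∉ M.outerFace →
      (d ∈ F ↔ M.rot o ∈ F) := by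
    intro o ho d hd hdi
    have hfst : ∀ i : ℕ, ((M.rot ^ i) o).fst = o.fst := by
      intro i
      induction i with
      | zero => rfl
      | succ i ih => rw [pow_succ', Equiv.Perm.mul_apply, M.rot_fst, ih]
    have walk : ∀ i : ℕ, (∀ j, 1 ≤ j → j ≤ i + 1 → (M.rot ^ j) o ≠ o) →
        ((M.rot ^ (i + 1)) o ∈ F ↔ M.rot o ∈ F) := by
      intro i
      induction i with
      | zero => intro _; simp
      | succ i ih =>
        intro h
        have hin : ∀ j, 1 ≤ j → j ≤ i + 1 + 1 → (M.rot ^ j) o ∉ M.outerFace := fun j h1 h2 hm =>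
          h j h1 h2 ((hO o.fst).unique ⟨hm, hfst j⟩ ⟨ho, rfl⟩)
        rw [← ih fun j h1 h2 => h j h1 (by omega), pow_succ' M.rot (i + 1), Equiv.Perm.mul_apply]
        refine step _ (hin _ (by omega) (by omega)) ?_
        rw [← Equiv.Perm.mul_apply, ← pow_succ']
        exact hin _ (by omega) le_rfl
    have hex : ∃ i : ℕ, (M.rot ^ i) o = d :=
      Equiv.Perm.SameCycle.exists_nat_pow_eq (M.rot_cyclic o d hd.symm)
    classical
    have hfind := Nat.find_spec hex
    have hpos : Nat.find hex ≠ 0 := by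
      intro h0
      rw [h0] at hfind
      exact hdi (by rw [← hfind]; exact ho)
    obtain ⟨i, hi⟩ := Nat.exists_eq_succ_of_ne_zero hpos
    rw [hi] at hfind
    rw [← hfind]
    refine walk i fun j h1 h2 hj => ?_
    refine Nat.find_min hex (m := i + 1 - j) (by omega) ?_
    rw [← hfind]
    conv_rhs => rw [show i.succ = (i + 1 - j) + j by omega, pow_add, Equiv.Perm.mul_apply, hj]
  have star' : ∀ d ∈ F, d ∉ M.outerFace → ∀ e, e.fst = d.fst → e ∉ M.outerFace → e ∈ F := by
    intro d hd hdi e he hei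
    obtain ⟨o, ⟨ho, hov⟩, -⟩ := hO d.fst
    exact (star o ho e (he.trans hov.symm) hei).2 ((star o ho d hov.symm hdi).1 hd)
  have hadj : ∀ v w, G.Adj v w → (∀ d : G.Dart, d.fst = v → d ∉ M.outerFace → d ∈ F) →
      ∀ d : G.Dart, d.fst = w → d ∉ M.outerFace → d ∈ F := by
    intro v w hvw hv e he hei
    set d : G.Dart := ⟨(v, w), hvw⟩ with hd
    by_cases hdo : d ∈ M.outerFace
    · have hs := M.symm_notMem_outerFace h3 hO hdo
      have h1 : M.facePerm d.symm ∈ F := by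
        refine hv _ ?_ (by rwa [M.mem_outerFace_facePerm])
        rw [M.facePerm_fst]
        rfl
      exact star' d.symm ((hF _).1 h1) hs e he hei
    · have h1 : M.facePerm d ∈ F := (hF _).2 (hv d rfl hdo)
      refine star' _ h1 (by rwa [M.mem_outerFace_facePerm]) e ?_ hei
      rw [M.facePerm_fst, he]
  have hall : ∀ v w, G.Walk v w → (∀ d : G.Dart, d.fst = v → d ∉ M.outerFace → d ∈ F) →
      ∀ d : G.Dart, d.fst = w → d ∉ M.outerFace → d ∈ F := by
    intro v w p
    induction p with
    | nil => exact id
    | cons h _ ih => exact fun hv => ih (hadj _ _ h hv)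
  intro d hd
  obtain ⟨p⟩ := M.connected.preconnected d₀.fst d.fst
  exact hall _ _ p (fun e he hei => star' d₀ hd₀ hi₀ e he hei) d rfl hd

/-- Euler's formula for a maximal outerplanar graph on `n` vertices: there are `2 * n - 3` edges and
at most `n - 2` inner faces. -/
theorem count {V : Type*} [Finite V] {G : SimpleGraph V} (M : PlaneEmbedding G)
    (hO : ∀ v : V, ∃! d : G.Dart, d ∈ M.outerFace ∧ d.fst = v)
    (hT : ∀ d : G.Dart, d ∉ M.outerFace → (M.face d).ncard = 3) :
    G.edgeSet.ncard + 3 = 2 * Nat.card V ∧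
      ∀ L : List G.Dart, (∀ d ∈ L, d ∉ M.outerFace) →
        L.Pairwise (fun d e => ¬ M.facePerm.SameCycle d e) → L.length + 2 ≤ Nat.card V := by
  classical
  have := Fintype.ofFinite V
  let q : G.Dart → Quotient (Equiv.Perm.SameCycle.setoid M.facePerm) := Quotient.mk _
  have hq : ∀ d e, q d = q e ↔ M.facePerm.SameCycle d e := fun d e => Quotient.eq
  have := Fintype.ofFinite (Quotient (Equiv.Perm.SameCycle.setoid M.facePerm))
  have hfib : ∀ d, (Finset.univ.filter fun e => q e = q d).card = (M.face d).ncard := by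
    intro d
    rw [← Set.ncard_coe_finset]
    congr 1
    ext e
    simp only [Finset.coe_filter, Finset.mem_univ, true_and, hq]
    exact ⟨fun h => h.symm, fun h => h.symm⟩
  have hout : (M.face M.outer).ncard = Fintype.card V := by
    have himg : (fun d : G.Dart => d.fst) '' M.outerFace = Set.univ := by
      ext v
      simp only [Set.mem_image, Set.mem_univ, iff_true]
      exact (hO v).exists
    have hinj : Set.InjOn (fun d : G.Dart => d.fst) M.outerFace := fun d hd e he h =>
      (hO e.fst).unique ⟨hd, h⟩ ⟨he, rfl⟩
    have := hinj.ncard_image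
    rw [himg, Set.ncard_univ, Nat.card_eq_fintype_card] at this
    exact this.symm
  have hdart : Fintype.card G.Dart = Fintype.card V +
      3 * (Fintype.card (Quotient (Equiv.Perm.SameCycle.setoid M.facePerm)) - 1) := by
    rw [← Finset.card_univ, Finset.card_eq_sum_card_fiberwise (f := q) (t := Finset.univ)
      (fun _ _ => Finset.mem_coe.2 (Finset.mem_univ _)),
      ← Finset.add_sum_erase _ _ (Finset.mem_univ (q M.outer)), hfib, hout]
    congr 1
    rw [Finset.sum_const_nat (m := 3), Finset.card_erase_of_mem (Finset.mem_univ _),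
      Finset.card_univ, mul_comm]
    intro c hc
    obtain ⟨d, rfl⟩ := Quotient.exists_rep c
    change (Finset.univ.filter fun e => q e = q d).card = 3
    rw [hfib, hT d]
    intro hd
    exact (Finset.mem_erase.1 hc).1 ((hq _ _).2 (Equiv.Perm.SameCycle.symm hd))
  have heuler := M.euler
  change Nat.card V + Nat.card (Quotient (Equiv.Perm.SameCycle.setoid M.facePerm)) = _ at heuler
  have hedge : G.edgeSet.ncard = G.edgeFinset.card := by
    rw [← Set.ncard_coe_finset, SimpleGraph.coe_edgeFinset]
  have htwice := G.dart_card_eq_twice_card_edges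
  have hpos : 0 < Fintype.card (Quotient (Equiv.Perm.SameCycle.setoid M.facePerm)) :=
    Fintype.card_pos_iff.2 ⟨q M.outer⟩
  rw [Nat.card_eq_fintype_card, Nat.card_eq_fintype_card] at heuler
  rw [Nat.card_eq_fintype_card]
  refine ⟨by omega, fun L hL hp => ?_⟩
  have hnd : (L.map q).Nodup := by
    rw [List.Nodup, List.pairwise_map]
    exact hp.imp fun h h' => h ((hq _ _).1 h')
  have hle : (L.map q).toFinset ⊆ Finset.univ.erase (q M.outer) := by
    intro c hc
    obtain ⟨d, hd, rfl⟩ := List.mem_map.1 (List.mem_toFinset.1 hc)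
    refine Finset.mem_erase.2 ⟨fun h => hL d hd ?_, Finset.mem_univ _⟩
    exact ((hq _ _).1 h).symm
  have := Finset.card_le_card hle
  rw [List.toFinset_card_of_nodup hnd, List.length_map, Finset.card_erase_of_mem
    (Finset.mem_univ _), Finset.card_univ] at this
  omega

end PlaneEmbedding

/-! ### Unfolding the inner faces into a tree -/

theorem inner_map {α β : Type*} (f : α → β) (t : BinaryTree α) :
    inner (t.map f) = (inner t).map f := by
  induction t with
  | nil => rfl
  | node z l r hl hr => simp [BinaryTree.map, inner, hl, hr]

namespace PlaneEmbedding

/-- The tree `t` is obtained by entering the inner faces of `M` one from another, beginning with the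
dart `d`. A node carries the dart through which its triangle is entered. -/
def IsUnfolding {V : Type*} {G : SimpleGraph V} (M : PlaneEmbedding G) :
    G.Dart → BinaryTree G.Dart → Prop
  | _, .nil => True
  | d, .node e l r => e = d ∧ d ∉ M.outerFace ∧
      IsUnfolding M (M.facePerm (M.facePerm d)).symm l ∧ IsUnfolding M (M.facePerm d).symm r

/-- The darts at which the unfolding `t` can be continued. -/
def exits {V : Type*} {G : SimpleGraph V} (M : PlaneEmbedding G) :
    G.Dart → BinaryTree G.Dart → List G.Dart
  | d, .nil => [d]
  | d, .node _ l r =>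
      exits M (M.facePerm (M.facePerm d)).symm l ++ exits M (M.facePerm d).symm r

/-- The vertex of a triangular face opposite to the dart `d`. -/
def apex {V : Type*} {G : SimpleGraph V} (M : PlaneEmbedding G) (d : G.Dart) : V :=
  (M.facePerm d).snd

section Unfolding

variable {V : Type*} {G : SimpleGraph V} (M : PlaneEmbedding G)

/-- An unfolding can be continued through any exit that lies on an inner face. -/
theorem exists_extension (t : BinaryTree G.Dart) :
    ∀ {d : G.Dart}, M.IsUnfolding d t → ∀ e ∈ M.exits d t, e ∉ M.outerFace →
      ∃ t', M.IsUnfolding d t' ∧ (inner t').Perm (e :: inner t) := by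
  induction t with
  | nil =>
    intro d _ e he hei
    rw [exits, List.mem_singleton] at he
    subst he
    exact ⟨.node e .nil .nil, ⟨rfl, hei, trivial, trivial⟩, List.Perm.refl _⟩
  | node a l r hl hr =>
    rintro d ⟨rfl, hdi, h1, h2⟩ e he hei
    rw [exits, List.mem_append] at he
    rcases he with he | he
    · obtain ⟨l', h3, h4⟩ := hl h1 e he hei
      refine ⟨.node a l' r, ⟨rfl, hdi, h3, h2⟩, ?_⟩
      exact ((h4.append_right (inner r)).cons a).trans (List.Perm.swap _ _ _)
    · obtain ⟨r', h3, h4⟩ := hr h2 e he hei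
      refine ⟨.node a l r', ⟨rfl, hdi, h1, h3⟩, ?_⟩
      exact (((h4.append_left (inner l)).trans List.perm_middle).cons a).trans
        (List.Perm.swap _ _ _)

theorem notMem_outerFace_of_mem_inner (t : BinaryTree G.Dart) :
    ∀ {d : G.Dart}, M.IsUnfolding d t → ∀ e ∈ inner t, e ∉ M.outerFace := by
  induction t with
  | nil => intro d _ e he; simp [inner] at he
  | node a l r hl hr =>
    rintro d ⟨rfl, hdi, h1, h2⟩ e he
    simp only [inner, List.mem_cons, List.mem_append] at he
    rcases he with rfl | he | he
    exacts [hdi, hl h1 e he, hr h2 e he]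

/-- The dart `d` at the root of an unfolding is one of its nodes, or one of its exits. -/
theorem mem_inner_or_mem_exits {d : G.Dart} {t : BinaryTree G.Dart} (h : M.IsUnfolding d t) :
    d ∈ inner t ∨ d ∈ M.exits d t := by
  cases t with
  | nil => exact Or.inr (by simp [exits])
  | node a l r => exact Or.inl (by simp [inner, h.1])

/-- Across its two other sides a triangle leads to further nodes or to exits. -/
theorem symm_mem_inner_or_mem_exits (t : BinaryTree G.Dart) :
    ∀ {d : G.Dart}, M.IsUnfolding d t → ∀ e ∈ inner t,
      ((M.facePerm e).symm ∈ inner t ∨ (M.facePerm e).symm ∈ M.exits d t) ∧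
      ((M.facePerm (M.facePerm e)).symm ∈ inner t ∨
        (M.facePerm (M.facePerm e)).symm ∈ M.exits d t) := by
  induction t with
  | nil => intro d _ e he; simp [inner] at he
  | node a l r hl hr =>
    rintro d ⟨rfl, hdi, h1, h2⟩ e he
    have k1 := M.mem_inner_or_mem_exits h1
    have k2 := M.mem_inner_or_mem_exits h2
    simp only [inner, exits, List.mem_cons, List.mem_append] at he ⊢
    rcases he with rfl | he | he
    · tauto
    · have := hl h1 e he; tauto
    · have := hr h2 e he; tauto

/-- Apart from the root, every node is entered from the triangle of another node. -/
theorem exists_sameCycle_symm (t : BinaryTree G.Dart) :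
    ∀ {d : G.Dart}, M.IsUnfolding d t → ∀ e ∈ inner t,
      e = d ∨ ∃ e' ∈ inner t, M.facePerm.SameCycle e' e.symm := by
  induction t with
  | nil => intro d _ e he; simp [inner] at he
  | node a l r hl hr =>
    rintro d ⟨rfl, hdi, h1, h2⟩ e he
    simp only [inner, List.mem_cons, List.mem_append] at he ⊢
    rcases he with rfl | he | he
    · exact Or.inl rfl
    · refine Or.inr ?_
      rcases hl h1 e he with rfl | ⟨e', he', h⟩
      · refine ⟨a, Or.inl rfl, ?_⟩
        rw [SimpleGraph.Dart.symm_symm, Equiv.Perm.sameCycle_apply_right,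
          Equiv.Perm.sameCycle_apply_right]
      · exact ⟨e', Or.inr (Or.inl he'), h⟩
    · refine Or.inr ?_
      rcases hr h2 e he with rfl | ⟨e', he', h⟩
      · refine ⟨a, Or.inl rfl, ?_⟩
        rw [SimpleGraph.Dart.symm_symm, Equiv.Perm.sameCycle_apply_right]
      · exact ⟨e', Or.inr (Or.inr he'), h⟩

theorem snd_facePerm_facePerm [Finite V]
    (hT : ∀ d : G.Dart, d ∉ M.outerFace → (M.face d).ncard = 3)
    {d : G.Dart} (hd : d ∉ M.outerFace) :
    (M.facePerm (M.facePerm d)).snd = d.fst := by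
  rw [← M.facePerm_fst, (M.face_eq (hT d hd)).2]

theorem isTriangulated_map_apex [Finite V]
    (hT : ∀ d : G.Dart, d ∉ M.outerFace → (M.face d).ncard = 3)
    (t : BinaryTree G.Dart) :
    ∀ {d : G.Dart}, M.IsUnfolding d t → IsTriangulated G d.fst d.snd (t.map M.apex) := by
  induction t with
  | nil => intros; trivial
  | node a l r hl hr =>
    rintro d ⟨rfl, hdi, h1, h2⟩
    have e1 := M.snd_facePerm_facePerm hT hdi
    have e2 := M.facePerm_fst (M.facePerm a)
    have e3 := M.facePerm_fst a
    refine ⟨?_, ?_, ?_, ?_⟩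
    · have := (M.facePerm (M.facePerm a)).adj
      rw [e1, e2] at this
      exact this.symm
    · have := (M.facePerm a).adj
      rw [e3] at this
      exact this.symm
    · have := hl h1
      change IsTriangulated G (M.facePerm (M.facePerm a)).snd (M.facePerm (M.facePerm a)).fst _
        at this
      rwa [e1, e2] at this
    · have := hr h2
      change IsTriangulated G (M.facePerm a).snd (M.facePerm a).fst _ at this
      rwa [e3] at this

theorem fst_snd_mem [Finite V]
    (hT : ∀ d : G.Dart, d ∉ M.outerFace → (M.face d).ncard = 3)
    (t : BinaryTree G.Dart) :
    ∀ {d : G.Dart}, M.IsUnfolding d t → ∀ e ∈ inner t,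
      e.fst ∈ d.fst :: d.snd :: inner (t.map M.apex) ∧
      e.snd ∈ d.fst :: d.snd :: inner (t.map M.apex) := by
  induction t with
  | nil => intro d _ e he; simp [inner] at he
  | node a l r hl hr =>
    rintro d ⟨rfl, hdi, h1, h2⟩ e he
    have e1 := M.snd_facePerm_facePerm hT hdi
    have e2 := M.facePerm_fst (M.facePerm a)
    have e3 := M.facePerm_fst a
    simp only [inner, BinaryTree.map, List.mem_cons, List.mem_append] at he ⊢
    rcases he with rfl | he | he
    · tauto
    · have := hl h1 e he
      change e.fst ∈ (M.facePerm (M.facePerm a)).snd :: (M.facePerm (M.facePerm a)).fst :: _ ∧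
        e.snd ∈ (M.facePerm (M.facePerm a)).snd :: (M.facePerm (M.facePerm a)).fst :: _ at this
      rw [e1, e2] at this
      simp only [List.mem_cons] at this
      unfold apex at *
      tauto
    · have := hr h2 e he
      change e.fst ∈ (M.facePerm a).snd :: (M.facePerm a).fst :: _ ∧
        e.snd ∈ (M.facePerm a).snd :: (M.facePerm a).fst :: _ at this
      rw [e3] at this
      simp only [List.mem_cons] at this
      unfold apex at *
      tauto

end Unfolding

end PlaneEmbedding

/-- A maximal outerplanar graph is a triangulated polygon, in the encoding by binary trees. -/
theorem exists_isTriangulated {V : Type*} [Finite V] {G : SimpleGraph V}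
    (hG : IsMaximalOuterplanar G) :
    ∃ (x y : V) (t : BinaryTree V), G.Adj x y ∧ IsTriangulated G x y t ∧
      (x :: y :: inner t).Nodup ∧ (∀ v, v ∈ x :: y :: inner t) ∧
      (inner t).length + 2 = Nat.card V ∧ G.edgeSet.ncard + 3 = 2 * Nat.card V := by
  classical
  obtain ⟨h3, M, hO, hT⟩ := hG
  have hfin : Finite G.Dart := Finite.of_injective _ (SimpleGraph.Dart.toProd_injective (G := G))
  obtain ⟨hedge, hcount⟩ := M.count hO hT
  set d₀ := M.outer.symm with hd₀
  have hout : M.outer ∈ M.outerFace := Equiv.Perm.SameCycle.refl _ _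
  have hi₀ : d₀ ∉ M.outerFace := M.symm_notMem_outerFace h3 hO hout
  -- An unfolding with distinct faces that is as large as possible.
  let Good : ℕ → Prop := fun n => ∃ t, M.IsUnfolding d₀ t ∧
    (inner t).Pairwise (fun d e => ¬ M.facePerm.SameCycle d e) ∧ (inner t).length = n
  have hgood : Good (Nat.findGreatest Good (Nat.card V)) :=
    Nat.findGreatest_spec (P := Good) (m := 0) (Nat.zero_le _)
      ⟨.nil, trivial, List.Pairwise.nil, rfl⟩
  obtain ⟨t, ht, hp, hlen⟩ := hgood
  let F : Set G.Dart := {d | ∃ e ∈ inner t, M.facePerm.SameCycle e d}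
  have hexit : ∀ e ∈ M.exits d₀ t, e ∉ M.outerFace → e ∈ F := by
    intro e he hei
    by_contra hnF
    obtain ⟨t', ht', hperm⟩ := M.exists_extension t ht e he hei
    have hp' : (inner t').Pairwise (fun d e => ¬ M.facePerm.SameCycle d e) := by
      refine (hperm.pairwise_iff fun h h' => h h'.symm).2 (List.pairwise_cons.2 ⟨?_, hp⟩)
      exact fun e' he' h => hnF ⟨e', he', h.symm⟩
    have hle := hcount _ (M.notMem_outerFace_of_mem_inner t' ht') hp'
    have hlt : Nat.findGreatest Good (Nat.card V) < (inner t').length := by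
      rw [hperm.length_eq, List.length_cons, hlen]; exact Nat.lt_succ_self _
    exact Nat.findGreatest_is_greatest hlt (by omega) ⟨t', ht', hp', rfl⟩
  have hFmem : ∀ e ∈ inner t, e ∈ F := fun e he => ⟨e, he, Equiv.Perm.SameCycle.refl _ _⟩
  have hface : ∀ d ∈ F, ∃ e ∈ inner t,
      d = e ∨ d = M.facePerm e ∨ d = M.facePerm (M.facePerm e) := by
    rintro d ⟨e, he, h⟩
    refine ⟨e, he, ?_⟩
    have : d ∈ M.face e := h
    rwa [(M.face_eq (hT e (M.notMem_outerFace_of_mem_inner t ht e he))).1] at this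
  have hFall : ∀ d, d ∉ M.outerFace → d ∈ F := by
    refine M.mem_of_closed h3 hO (fun d => ?_) (fun d hd hds => ?_) (d₀ := d₀) ?_ hi₀
    · exact ⟨fun ⟨e, he, h⟩ => ⟨e, he, Equiv.Perm.sameCycle_apply_right.1 h⟩,
        fun ⟨e, he, h⟩ => ⟨e, he, Equiv.Perm.sameCycle_apply_right.2 h⟩⟩
    · obtain ⟨e, he, rfl | rfl | rfl⟩ := hface d hd
      · rcases M.exists_sameCycle_symm t ht d he with rfl | h
        · exact absurd (by simpa [hd₀] using hout) hds
        · exact h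
      · exact (M.symm_mem_inner_or_mem_exits t ht e he).1.elim (hFmem _) (hexit _ · hds)
      · exact (M.symm_mem_inner_or_mem_exits t ht e he).2.elim (hFmem _) (hexit _ · hds)
    · exact (M.mem_inner_or_mem_exits ht).elim (hFmem _) (hexit _ · hi₀)
  have hcover : ∀ v, v ∈ d₀.fst :: d₀.snd :: inner (t.map M.apex) := by
    intro v
    obtain ⟨o, ⟨ho, rfl⟩, -⟩ := hO v
    -- The dart after the outer one around a vertex lies on an inner face.
    have hdi : M.facePerm o.symm ∉ M.outerFace := by
      rw [M.mem_outerFace_facePerm]; exact M.symm_notMem_outerFace h3 hO ho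
    have hfst : (M.facePerm o.symm).fst = o.fst := M.facePerm_fst _
    rw [← hfst]
    obtain ⟨e, he, h | h | h⟩ := hface _ (hFall _ hdi)
    · rw [h]; exact (M.fst_snd_mem hT t ht e he).1
    · rw [h, M.facePerm_fst]; exact (M.fst_snd_mem hT t ht e he).2
    · rw [h, M.facePerm_fst, inner_map]
      exact List.mem_cons_of_mem _ (List.mem_cons_of_mem _ (List.mem_map_of_mem he))
  have hle := hcount _ (M.notMem_outerFace_of_mem_inner t ht) hp
  have hlen' : (inner (t.map M.apex)).length = (inner t).length := by
    rw [inner_map, List.length_map]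
  -- There are too few places in the tree for any vertex to occur twice.
  have hcard : Nat.card V ≤ (d₀.fst :: d₀.snd :: inner (t.map M.apex)).toFinset.card := by
    rw [← Set.ncard_univ, ← Set.ncard_coe_finset]
    exact Set.ncard_le_ncard (fun v _ => by simpa using hcover v) (Finset.finite_toSet _)
  have hcard' := List.toFinset_card_le (d₀.fst :: d₀.snd :: inner (t.map M.apex))
  refine ⟨d₀.fst, d₀.snd, t.map M.apex, d₀.adj, M.isTriangulated_map_apex hT t ht, ?_, hcover,
    ?_, hedge⟩
  · refine Multiset.toFinset_card_eq_card_iff_nodup.1 (le_antisymm (List.toFinset_card_le _) ?_)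
    simp only [List.length_cons] at hcard' ⊢
    exact le_trans (by simp only [Multiset.coe_card, List.length_cons]; omega) hcard
  · simp only [List.length_cons] at hcard'
    omega

/-! ### The bound, and its sharpness -/

theorem nine_mul_disjunctiveDominationNumber_le {V : Type*} [Finite V] {G : SimpleGraph V}
    (hG : IsMaximalOuterplanar G) (h7 : 7 ≤ Nat.card V) :
    9 * disjunctiveDominationNumber G ≤ 2 * (Nat.card V + numDegreeTwo G) := by
  classical
  obtain ⟨x, y, t, hxy, ht, hn, hcover, hlen, hedge⟩ := exists_isTriangulated hG
  cases t with
  | nil => simp only [inner, List.length_nil] at hlen; omega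
  | node z l r =>
    obtain ⟨S, hS, hcard⟩ := exists_partDom hxy ht hn (by omega)
    have hk := le_numDegreeTwo hxy ht hn (by omega)
    have hle : disjunctiveDominationNumber G ≤ S.card :=
      Nat.sInf_le ⟨S, isDisjunctiveDominating_of_partDom fun v => hS v (hcover v),
        Set.ncard_coe_finset S⟩
    omega

theorem disjunctiveDominationNumber_le_floor {V : Type*} [Finite V] {G : SimpleGraph V}
    (hG : IsMaximalOuterplanar G) (h7 : 7 ≤ Nat.card V) :
    disjunctiveDominationNumber G ≤
      ⌊(2 / 9 : ℚ) * ((Nat.card V : ℚ) + (numDegreeTwo G : ℚ))⌋₊ := by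
  have h : (9 : ℚ) * disjunctiveDominationNumber G ≤ 2 * (Nat.card V + numDegreeTwo G) := by
    exact_mod_cast nine_mul_disjunctiveDominationNumber_le hG h7
  refine Nat.le_floor ?_
  linarith

namespace Strip

/-- The triangulated strip on seven vertices, that is, the square of a path. The even vertices
`0, 2, 4, 6` form its lower side and the odd vertices `1, 3, 5` its upper side. -/
def strip : SimpleGraph (Fin 7) where
  Adj i j := i ≠ j ∧ (i : ℕ) ≤ j + 2 ∧ (j : ℕ) ≤ i + 2
  symm := ⟨fun _ _ h => ⟨h.1.symm, h.2.2, h.2.1⟩⟩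
  loopless := ⟨fun _ h => h.1 rfl⟩

instance : DecidableRel strip.Adj := fun i j =>
  inferInstanceAs (Decidable (i ≠ j ∧ (i : ℕ) ≤ j + 2 ∧ (j : ℕ) ≤ i + 2))

/-- The neighbour of `v` that follows its neighbour `w` in the counterclockwise order: this order
is `v + 2, v + 1, v - 1, v - 2` on the lower side, and `v + 2, v - 2, v - 1, v + 1` on the upper
side. The entries for vertices `w` that are not neighbours of `v` are irrelevant. -/
def next : Fin 7 → Fin 7 → Fin 7 :=
  ![![0, 2, 1, 0, 0, 0, 0],
    ![2, 0, 3, 0, 0, 0, 0],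
    ![4, 0, 0, 1, 3, 0, 0],
    ![0, 2, 4, 0, 5, 1, 0],
    ![0, 0, 6, 2, 0, 3, 5],
    ![0, 0, 0, 4, 6, 0, 3],
    ![0, 0, 0, 0, 5, 4, 0]]

theorem adj_next : ∀ v w, strip.Adj v w → strip.Adj v (next v w) := by decide +kernel

/-- The rotation of the strip, as a function. -/
def rotFun (d : strip.Dart) : strip.Dart := ⟨(d.fst, next d.fst d.snd), adj_next _ _ d.adj⟩

theorem rotFun_injective : Function.Injective rotFun := by
  have h : ∀ d e : strip.Dart, rotFun d = rotFun e → d = e := by decide +kernel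
  exact fun d e => h d e

/-- The rotation of the strip. -/
noncomputable def rot : Equiv.Perm strip.Dart :=
  Equiv.ofBijective rotFun (Finite.injective_iff_bijective.1 rotFun_injective)

/-- The face permutation of the strip. -/
noncomputable def facePerm : Equiv.Perm strip.Dart :=
  (SimpleGraph.Dart.symm_involutive (G := strip)).toPerm.trans rot

/-- The face to which a dart belongs: `i` stands for the triangle `i, i + 1, i + 2`, and `5` for
the outer face. The entries for pairs of vertices that are not adjacent are irrelevant. -/
def faceIndex (d : strip.Dart) : Fin 6 :=
  (![![5, 0, 5, 5, 5, 5, 5],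
     ![5, 5, 0, 1, 5, 5, 5],
     ![0, 1, 5, 2, 5, 5, 5],
     ![5, 5, 1, 5, 2, 3, 5],
     ![5, 5, 2, 3, 5, 4, 5],
     ![5, 5, 5, 5, 3, 5, 4],
     ![5, 5, 5, 5, 4, 5, 5]] : Fin 7 → Fin 7 → Fin 6) d.fst d.snd

theorem sameCycle_of_iterate {α : Type*} {f : Equiv.Perm α} {g : α → α} (hfg : ∀ a, f a = g a)
    {a b : α} (h : ∃ k < 7, g^[k] a = b) : f.SameCycle a b := by
  obtain ⟨k, -, rfl⟩ := h
  have hg : (f : α → α) = g := funext hfg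
  refine ⟨k, ?_⟩
  rw [zpow_natCast, ← Equiv.Perm.iterate_eq_pow, hg]

theorem sameCycle_facePerm_iff (d e : strip.Dart) :
    facePerm.SameCycle d e ↔ faceIndex d = faceIndex e := by
  constructor
  · have h : ∀ d, faceIndex (rotFun d.symm) = faceIndex d := by decide +kernel
    have h' : ∀ d, faceIndex (facePerm d) = faceIndex d := h
    rintro hde
    obtain ⟨k, rfl⟩ := Equiv.Perm.SameCycle.exists_nat_pow_eq hde
    induction k with
    | zero => rfl
    | succ k ih =>
      rw [pow_succ', Equiv.Perm.mul_apply, h']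
      exact ih ⟨k, rfl⟩
  · intro hde
    have h : ∀ d e, faceIndex d = faceIndex e → ∃ k < 7, (fun d => rotFun d.symm)^[k] d = e := by
      decide +kernel
    exact sameCycle_of_iterate (g := fun d => rotFun d.symm) (fun _ => rfl) (h d e hde)

theorem card_faces : Nat.card (Quotient (Equiv.Perm.SameCycle.setoid facePerm)) = 6 := by
  have hsurj : ∀ i, ∃ d, faceIndex d = i := by decide +kernel
  let f : Quotient (Equiv.Perm.SameCycle.setoid facePerm) → Fin 6 :=
    Quotient.lift faceIndex fun d e h => (sameCycle_facePerm_iff d e).1 h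
  have hf : Function.Bijective f := by
    refine ⟨?_, fun i => (hsurj i).imp' (Quotient.mk _) fun _ => id⟩
    rintro ⟨d⟩ ⟨e⟩ h
    exact Quotient.sound ((sameCycle_facePerm_iff d e).2 h)
  rw [Nat.card_eq_of_bijective f hf, Nat.card_fin]

theorem ncard_edgeSet : strip.edgeSet.ncard = 11 := by
  have h : Fintype.card strip.Dart = 22 := by decide +kernel
  have htwice := strip.dart_card_eq_twice_card_edges
  rw [← SimpleGraph.coe_edgeFinset, Set.ncard_coe_finset]
  omega

theorem connected : strip.Connected := by
  refine (SimpleGraph.pathGraph_connected 6).mono ?_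
  intro i j h
  rw [SimpleGraph.pathGraph_adj] at h
  exact ⟨fun hij => by rw [hij] at h; omega, by omega, by omega⟩

/-- The strip, drawn in the plane. -/
noncomputable def embedding : PlaneEmbedding strip where
  rot := rot
  rot_fst _ := rfl
  rot_cyclic d e hde := by
    have h : ∀ d e : strip.Dart, d.fst = e.fst → ∃ k < 7, rotFun^[k] d = e := by decide +kernel
    exact sameCycle_of_iterate (g := rotFun) (fun _ => rfl) (h d e hde)
  connected := connected
  euler := by
    change _ + Nat.card (Quotient (Equiv.Perm.SameCycle.setoid facePerm)) = _
    rw [card_faces, ncard_edgeSet, Nat.card_fin]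
  outer := ⟨(0, 2), by decide⟩

theorem mem_outerFace (d : strip.Dart) : d ∈ embedding.outerFace ↔ faceIndex d = 5 :=
  (sameCycle_facePerm_iff embedding.outer d).trans eq_comm

theorem isMaximalOuterplanar : IsMaximalOuterplanar strip := by
  refine ⟨by simp, embedding, ?_, ?_⟩
  · simp only [mem_outerFace]
    have hex : ∀ v, ∃ d : strip.Dart, faceIndex d = 5 ∧ d.fst = v := by decide +kernel
    have huniq : ∀ d e : strip.Dart, faceIndex d = 5 → faceIndex e = 5 → d.fst = e.fst → d = e := by
      decide +kernel
    intro v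
    obtain ⟨d, hd, hv⟩ := hex v
    exact ⟨d, ⟨hd, hv⟩, fun e he => huniq e d he.1 hd (he.2.trans hv.symm)⟩
  · intro d hd
    rw [mem_outerFace] at hd
    have hface : embedding.face d = (Finset.univ.filter fun e => faceIndex d = faceIndex e) := by
      ext e
      rw [Finset.coe_filter]
      simp only [Finset.mem_univ, true_and]
      exact sameCycle_facePerm_iff d e
    have h : ∀ d, faceIndex d ≠ 5 →
        (Finset.univ.filter fun e => faceIndex d = faceIndex e).card = 3 := by decide +kernel
    rw [hface, Set.ncard_coe_finset, h d hd]

theorem numDegreeTwo_eq : numDegreeTwo strip = 2 := by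
  have hdeg : ∀ v, (strip.neighborSet v).ncard = strip.degree v := fun v => by
    have h := Set.ncard_coe_finset (strip.neighborFinset v)
    rwa [SimpleGraph.coe_neighborFinset] at h
  have hset : {v | (strip.neighborSet v).ncard = 2} =
      (Finset.univ.filter fun v => strip.degree v = 2) := by
    ext v
    simp [hdeg]
  rw [numDegreeTwo, hset, Set.ncard_coe_finset]
  decide +kernel

theorem two_le : 2 ≤ disjunctiveDominationNumber strip := by
  obtain ⟨S, hS, hcard⟩ : disjunctiveDominationNumber strip ∈
      {m | ∃ S : Set (Fin 7), IsDisjunctiveDominating strip S ∧ S.ncard = m} :=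
    Nat.sInf_mem ⟨_, Set.univ, fun v hv => absurd (Set.mem_univ v) hv, rfl⟩
  by_contra! hlt
  -- A set with at most one element lies in some `{s}`, and no vertex is adjacent to all others.
  obtain ⟨s, hs⟩ : ∃ s, S ⊆ {s} := by
    rw [← hcard] at hlt
    have hle : S.ncard ≤ 1 := by omega
    rcases Set.eq_empty_or_nonempty S with rfl | ⟨s, hs⟩
    · exact ⟨0, Set.empty_subset _⟩
    · exact ⟨s, fun u hu => (Set.ncard_le_one (Set.toFinite _)).1 hle u hu s hs⟩
  have hfar : ∀ s, ∃ v, v ≠ s ∧ ¬ strip.Adj v s := by decide +kernel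
  obtain ⟨v, hv, hadj⟩ := hfar s
  rcases hS v fun h => hv (hs h) with ⟨u, hu, h⟩ | ⟨u, hu, w, hw, huw, -⟩
  · rw [hs hu] at h
    exact hadj h
  · exact huw ((hs hu).trans (hs hw).symm)

end Strip

end DisjDom

theorem theorem1 :
    (∀ (V : Type*) [Finite V] (G : SimpleGraph V),
      DisjDom.IsMaximalOuterplanar G → 7 ≤ Nat.card V →
      DisjDom.disjunctiveDominationNumber G
        ≤ ⌊(2 / 9 : ℚ) * ((Nat.card V : ℚ) + (DisjDom.numDegreeTwo G : ℚ))⌋₊) ∧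
    (∃ n : ℕ, 7 ≤ n ∧ ∃ G : SimpleGraph (Fin n),
      DisjDom.IsMaximalOuterplanar G ∧
      DisjDom.disjunctiveDominationNumber G
        = ⌊(2 / 9 : ℚ) * ((n : ℚ) + (DisjDom.numDegreeTwo G : ℚ))⌋₊) := by
  refine ⟨fun V _ G hG h7 => DisjDom.disjunctiveDominationNumber_le_floor hG h7, 7, le_rfl,
    DisjDom.Strip.strip, DisjDom.Strip.isMaximalOuterplanar, ?_⟩
  have hle := DisjDom.disjunctiveDominationNumber_le_floor DisjDom.Strip.isMaximalOuterplanar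
    (by simp)
  have hfloor : ⌊(2 / 9 : ℚ) * (((7 : ℕ) : ℚ) + (DisjDom.numDegreeTwo DisjDom.Strip.strip : ℚ))⌋₊
      = 2 := by
    rw [DisjDom.Strip.numDegreeTwo_eq]
    norm_num
  rw [Nat.card_fin, hfloor] at hle
  rw [hfloor]
  exact le_antisymm hle DisjDom.Strip.two_le
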